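/- Let $\mathbf V$ be a dagger compact category: a symmetric monoidal category in which every object $A$ has a chosen dual $A^*$, with maps $\eta_A : I \to A^*\otimes A$ and $\varepsilon_A : A\otimes A^* \to I$ satisfying the snake equations, equipped with an identity-on-objects involutive contravariant functor $\dagger$ such that $(f\otimes g)^\dagger=f^\dagger\otimes g^\dagger$, the structure isomorphisms $\alpha,\lambda,\sigma$ are unitary, and $\sigma_{A,A^*}\circ\varepsilon_A^\dagger=\eta_A$. Coherence isomorphisms are suppressed below. For $g : A\to B$ let $g_*=(g^\dagger)^* : A^*\to B^*$ be the transpose of $g^\dagger$, where for $B = X\otimes B'$ one uses the dual $B'^*\otimes X^*$. A dagger Frobenius algebra is an object $A$ with an associative multiplication $\mu_A : A\otimes A\to A$ with unit $u_A : I\to A$ satisfying the Frobenius law $(1\otimes\mu_A)(\mu_A^\dagger\otimes 1)=\mu_A^\dagger\mu_A=(\mu_A\otimes 1)(1\otimes\mu_A^\dagger)$. It is normalisable when there is $z : A\to A$ that is central ($\mu_A(z\otimes 1)=z\mu_A=\mu_A(1\otimes z)$) and positive definite (an isomorphism of the form $z=h^\dagger h$ for some $h : A \to Y$), and satisfies $\operatorname{Tr}_A(\mu_A)\circ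 z\circ z=u_A^\dagger$, where $\operatorname{Tr}_A(\mu_A)=\varepsilon_A(\mu_A\otimes 1_{A^*})(1_A\otimes\varepsilon_A^\dagger) : A\to I$. The tensor product $A\otimes C$ of two algebras carries the multiplication $(\mu_A\otimes\mu_C)(1\otimes\sigma_{C,A}\otimes 1)$ and unit $u_A\otimes u_C$. The abstract matrix algebra on an object $X$ is $X^*\otimes X$ with multiplication $1_{X^*}\otimes\varepsilon_X\otimes 1_X$ and unit $\eta_X$. For an algebra $A$, let $a_A=(1_{A^*}\otimes\mu_A)(\eta_A\otimes 1_A) : A\to A^*\otimes A$. A morphism $f : A\to B$ between algebras satisfies the CP*-condition when there are an object $X$ and a morphism $g : A\to X\otimes B$ such that $$a_B\circ f\circ a_A^\dagger=(1_{B^*}\otimes\eta_X^\dagger\otimes 1_B)\circ(g_*\otimes g) : A^*\otimes A\to B^*\otimes B.$$ A positive element of $A$ is a morphism $I\to A$ satisfying the CP*-condition, where $I$ has its canonical algebra structure. Let $A$ and $B$ be normalisable dagger Frobenius algebras in $\mathbf V$, and let $f : A\to B$ be a morphism of $\mathbf V$. Then the following are equivalent: (a) $f$ satisfies the CP*-condition;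 (b) for every normalisable dagger Frobenius algebra $C$ in $\mathbf V$, composition with $f\otimes 1_C$ sends positive elements of $A\otimes C$ to positive elements of $B\otimes C$; (c) for every object $X$ of $\mathbf V$, composition with $f\otimes 1_{X^*\otimes X}$ sends positive elements of $A\otimes(X^*\otimes X)$ to positive elements of $B\otimes(X^*\otimes X)$, where $X^*\otimes X$ is the abstract matrix algebra on $X$. -/

import Mathlib

open CategoryTheory MonoidalCategory MonObj

namespace CPStar

universe v u

/-- A dagger on a category: an identity-on-objects contravariant involution. -/
class DaggerCategory (V : Type u) [Category.{v} V] where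
  /-- The dagger of a morphism. -/
  dag {X Y : V} (f : X ⟶ Y) : Y ⟶ X
  dag_id (X : V) : dag (𝟙 X) = 𝟙 X
  dag_comp {X Y Z : V} (f : X ⟶ Y) (g : Y ⟶ Z) : dag (f ≫ g) = dag g ≫ dag f
  dag_dag {X Y : V} (f : X ⟶ Y) : dag (dag f) = f

open DaggerCategory

/-- A dagger compact category. The chosen dual of `X` is `ᘁX`, with cup
`η_ (ᘁX) X : 𝟙_ V ⟶ ᘁX ⊗ X` and cap `ε_ (ᘁX) X : X ⊗ ᘁX ⟶ 𝟙_ V` satisfying the snake equations.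
The dagger preserves tensor products, the structure isomorphisms are unitary, and the dagger of
the cap of `X` is the cup of `ᘁX`, that is, it agrees with the cup of `X` up to the symmetry. -/
class DaggerCompactCategory (V : Type u) [Category.{v} V] [MonoidalCategory V]
    [SymmetricCategory V] [LeftRigidCategory V] extends DaggerCategory V where
  dag_tensorHom {X₁ Y₁ X₂ Y₂ : V} (f : X₁ ⟶ Y₁) (g : X₂ ⟶ Y₂) :
    dag (f ⊗ₘ g) = dag f ⊗ₘ dag g
  dag_associator (X Y Z : V) : dag (α_ X Y Z).hom = (α_ X Y Z).inv
  dag_leftUnitor (X : V) : dag (λ_ X).hom = (λ_ X).inv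
  dag_braiding (X Y : V) : dag (β_ X Y).hom = (β_ X Y).inv
  dag_evaluation (X : V) :
    dag (ε_ (ᘁX) X) ≫ (β_ X (ᘁX)).hom = η_ (ᘁX) X

section Positivity

variable {V : Type u} [Category.{v} V] [DaggerCategory V]

/-- A positive endomorphism: one of the form `h† ∘ h`. -/
def IsPositiveMap {X : V} (g : X ⟶ X) : Prop :=
  ∃ (Y : V) (h : X ⟶ Y), g = h ≫ dag h

/-- A positive definite endomorphism: a positive isomorphism. -/
def IsPositiveDefinite {X : V} (g : X ⟶ X) : Prop :=
  IsPositiveMap g ∧ IsIso g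

end Positivity

section Algebras

variable {V : Type u} [Category.{v} V] [MonoidalCategory V]

section Dagger

variable [DaggerCategory V]

/-- The comultiplication, the dagger of the multiplication. -/
def comul (A : V) [MonObj A] : A ⟶ A ⊗ A := dag μ[A]

/-- The counit, the dagger of the unit. -/
def counit (A : V) [MonObj A] : A ⟶ 𝟙_ V := dag η[A]

/-- A monoid object is a dagger Frobenius algebra when it satisfies the Frobenius law
with respect to the daggers of its multiplication and unit. -/
structure IsDaggerFrobenius (A : V) [MonObj A] : Prop where
  frobenius_left : comul A ▷ A ≫ (α_ A A A).hom ≫ A ◁ μ[A] = μ[A] ≫ comul A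
  frobenius_right : A ◁ comul A ≫ (α_ A A A).inv ≫ μ[A] ▷ A = μ[A] ≫ comul A

end Dagger

/-- A central map for the multiplication of `A`. -/
structure IsCentral {A : V} [MonObj A] (z : A ⟶ A) : Prop where
  left : z ▷ A ≫ μ[A] = μ[A] ≫ z
  right : A ◁ z ≫ μ[A] = μ[A] ≫ z

/-- The object `X* ⊗ X` underlying the abstract matrix algebra on `X`. -/
def MatrixAlg [LeftRigidCategory V] (X : V) : V := (ᘁX : V) ⊗ X

/-- The multiplication of the abstract matrix algebra ("pair of pants"): cap off the two inner
legs of `(X* ⊗ X) ⊗ (X* ⊗ X)`. -/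
def pantsMul [LeftRigidCategory V] (X : V) :
    ((ᘁX : V) ⊗ X) ⊗ ((ᘁX : V) ⊗ X) ⟶ (ᘁX : V) ⊗ X :=
  (α_ (ᘁX : V) X ((ᘁX : V) ⊗ X)).hom ≫
    (ᘁX : V) ◁ ((α_ X (ᘁX : V) X).inv ≫ ε_ (ᘁX) X ▷ X ≫ (λ_ X).hom)

theorem pants_one_mul [LeftRigidCategory V] (X : V) :
    η_ (ᘁX) X ▷ ((ᘁX : V) ⊗ X) ≫ pantsMul X = (λ_ ((ᘁX : V) ⊗ X)).hom := by
  calc _ = 𝟙 _ ⊗≫ (η_ (ᘁX : V) X ▷ (ᘁX : V) ⊗≫ (ᘁX : V) ◁ ε_ (ᘁX : V) X) ▷ X ⊗≫ 𝟙 _ := by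
        simp only [pantsMul]; monoidal
    _ = _ := by rw [ExactPairing.evaluation_coevaluation'' (ᘁX : V) X]; monoidal

theorem pants_mul_one [LeftRigidCategory V] (X : V) :
    ((ᘁX : V) ⊗ X) ◁ η_ (ᘁX) X ≫ pantsMul X = (ρ_ ((ᘁX : V) ⊗ X)).hom := by
  calc _ = 𝟙 _ ⊗≫ (ᘁX : V) ◁ (X ◁ η_ (ᘁX) X ⊗≫ ε_ (ᘁX) X ▷ X) ⊗≫ 𝟙 _ := by
        simp only [pantsMul]; monoidal
    _ = _ := by rw [ExactPairing.coevaluation_evaluation'' (ᘁX : V) X]; monoidal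

theorem pants_mul_assoc [LeftRigidCategory V] (X : V) :
    pantsMul X ▷ ((ᘁX : V) ⊗ X) ≫ pantsMul X =
      (α_ ((ᘁX : V) ⊗ X) ((ᘁX : V) ⊗ X) ((ᘁX : V) ⊗ X)).hom ≫
        ((ᘁX : V) ⊗ X) ◁ pantsMul X ≫ pantsMul X := by
  calc _ = 𝟙 _ ⊗≫ (ᘁX : V) ◁ (ε_ (ᘁX) X ▷ (X ⊗ (ᘁX : V)) ≫ 𝟙_ V ◁ ε_ (ᘁX) X) ▷ X ⊗≫ 𝟙 _ := by
        simp only [pantsMul]; monoidal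
    _ = 𝟙 _ ⊗≫ (ᘁX : V) ◁ ((X ⊗ (ᘁX : V)) ◁ ε_ (ᘁX) X ≫ ε_ (ᘁX) X ▷ 𝟙_ V) ▷ X ⊗≫ 𝟙 _ := by
        rw [whisker_exchange]
    _ = _ := by simp only [pantsMul]; monoidal

/-- The abstract matrix algebra `X* ⊗ X`, with unit the cup. -/
instance [LeftRigidCategory V] (X : V) : MonObj (MatrixAlg X) where
  one := η_ (ᘁX) X
  mul := pantsMul X
  one_mul := pants_one_mul X
  mul_one := pants_mul_one X
  mul_assoc := pants_mul_assoc X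

end Algebras

section DaggerCompact

variable {V : Type u} [Category.{v} V] [MonoidalCategory V] [SymmetricCategory V]
  [LeftRigidCategory V] [DaggerCompactCategory V]

/-- The loop `A ⟶ I`: the partial trace of the multiplication over its second input. -/
def loop (A : V) [MonObj A] : A ⟶ 𝟙_ V :=
  (ρ_ A).inv ≫ A ◁ dag (ε_ (ᘁA) A) ≫ (α_ A A (ᘁA)).inv ≫ μ[A] ▷ (ᘁA : V) ≫ ε_ (ᘁA) A

/-- A normaliser: a central, positive definite map `z` with `Tr_A(μ) ∘ z ∘ z` equal to the
counit. -/
structure IsNormaliser {A : V} [MonObj A] (z : A ⟶ A) : Prop where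
  central : IsCentral z
  posDef : IsPositiveDefinite z
  loop_eq : z ≫ z ≫ loop A = counit A

/-- A normalisable dagger Frobenius algebra (abstract C*-algebra). -/
structure IsNormalisable (A : V) [MonObj A] : Prop where
  frobenius : IsDaggerFrobenius A
  exists_normaliser : ∃ z : A ⟶ A, IsNormaliser z

/-- The action `A ⟶ A* ⊗ A`: the multiplication with its left input bent upwards. -/
def action (A : V) [MonObj A] : A ⟶ (ᘁA : V) ⊗ A :=
  (λ_ A).inv ≫ η_ (ᘁA) A ▷ A ≫ (α_ (ᘁA : V) A A).hom ≫ (ᘁA : V) ◁ μ[A]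

/-- The coaction `A* ⊗ A ⟶ A`, the dagger of the action: the comultiplication with its left
output bent downwards. -/
def coaction (A : V) [MonObj A] : (ᘁA : V) ⊗ A ⟶ A := dag (action A)

/-- The lower star `g_* = (g†)^* : A' ⟶ B'` of `g : A ⟶ B`, where `A'` and `B'` are duals of
`A` and `B`. -/
def lowerStar {A' A B' B : V} [ExactPairing A' A] [ExactPairing B' B] (g : A ⟶ B) : A' ⟶ B' :=
  (λ_ A').inv ≫ η_ B' B ▷ A' ≫ (B' ◁ dag g) ▷ A' ≫ (α_ B' A A').hom ≫ B' ◁ ε_ A' A ≫ (ρ_ B').hom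

/-- For `g : A ⟶ X ⊗ B`, the map `A* ⊗ A ⟶ B* ⊗ B` obtained from `g_* ⊗ g`, where
`g_* : A* ⟶ B* ⊗ X*`, by joining the two wires labelled `X`. -/
def krausForm {A X B : V} (g : A ⟶ X ⊗ B) : (ᘁA : V) ⊗ A ⟶ (ᘁB : V) ⊗ B :=
  ((lowerStar g : (ᘁA : V) ⟶ (ᘁB : V) ⊗ (ᘁX : V)) ⊗ₘ g) ≫
    (α_ (ᘁB : V) (ᘁX : V) (X ⊗ B)).hom ≫
    (ᘁB : V) ◁ ((α_ (ᘁX : V) X B).inv ≫ dag (η_ (ᘁX) X) ▷ B ≫ (λ_ B).hom)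

/-- The CP*-condition: `action ∘ f ∘ coaction` is of the form `krausForm g` for some object `X`
and some Kraus map `g : A ⟶ X ⊗ B`. -/
def SatisfiesCPStar {A B : V} [MonObj A] [MonObj B] (f : A ⟶ B) : Prop :=
  ∃ (X : V) (g : A ⟶ X ⊗ B), coaction A ≫ f ≫ action B = krausForm g

/-- The positive elements of `A`: the maps `I ⟶ A` satisfying the CP*-condition, where the tensor
unit `I` carries its canonical algebra structure. -/
def IsPositiveElement {A : V} [MonObj A] (a : 𝟙_ V ⟶ A) : Prop :=
  SatisfiesCPStar a

/-- A map between algebras that sends positive elements to positive elements. -/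
def PreservesPositive {A B : V} [MonObj A] [MonObj B] (f : A ⟶ B) : Prop :=
  ∀ a : 𝟙_ V ⟶ A, IsPositiveElement a → IsPositiveElement (a ≫ f)

end DaggerCompact

end CPStar

namespace CPStar

open DaggerCategory

universe v u

/-! ### Duals, multiplications and the action into a matrix algebra. -/

section Monoidal

variable {V : Type u} [Category.{v} V] [MonoidalCategory V]

/-! Write `R_a` for right multiplication by an element `a`. Everything is reduced to positivity of
endomorphisms. Capping off the `B*` leg turns the CP*-condition on `f` into a Stinespring form
(`satisfiesCPStar_iff`); for maps out of `I` this says that `a` is positive iff `R_a = h†h`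
(`isPositiveElement_iff`).

From (a) to preservation: the normaliser gives `action† ∘ action ∘ z² = 1`, so the Stinespring form
becomes a dilation `R_{f(a)} = k† (1 ⊗ R_a) k` (`exists_dilation`). It survives tensoring with any
algebra `C` (`rightMul_comp_whiskerRight`), and such a compression of a positive map is positive.

From (c) to (b): the action embeds `C` multiplicatively in the matrix algebra `C* ⊗ C`. Pushing `p`
along it changes `R_p` into `1 ⊗ R_p` up to a symmetry, so positivity is kept. When `C` is
normalisable, `action ∘ z` is an isometry and compressing along it recovers `R_p`, so positivity is
also reflected.

From (b) to (a): this is a Choi argument. The dagger of the Frobenius form is an element of `A ⊗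
Aᵒᵖ`, positive by the Frobenius law. Positivity of its image under `f ⊗ 1` yields `h†h`, and bending
the `A` wires of `h` gives the Stinespring map of `f`. That `Aᵒᵖ` is an admissible test algebra
rests on symmetry of the Frobenius form, which follows from the counit being a central multiple of a
trace (`IsNormalisable.cap_symm`). -/

theorem coevaluation_comp_evaluation_tensorUnit (D : V) [ExactPairing D (𝟙_ V)] :
    η_ D (𝟙_ V) ≫ (ρ_ D).hom ≫ (λ_ D).inv ≫ ε_ D (𝟙_ V) = 𝟙 _ := by
  calc _ = 𝟙 _ ⊗≫ ((𝟙_ V) ◁ η_ D (𝟙_ V) ≫ (α_ _ _ _).inv ≫ ε_ D (𝟙_ V) ▷ (𝟙_ V)) ⊗≫ 𝟙 _ := by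
        monoidal
    _ = _ := by
        rw [ExactPairing.coevaluation_evaluation]; monoidal

theorem evaluation_comp_coevaluation_tensorUnit (D : V) [ExactPairing D (𝟙_ V)] :
    ((ρ_ D).hom ≫ (λ_ D).inv ≫ ε_ D (𝟙_ V)) ≫ η_ D (𝟙_ V) = 𝟙 _ := by
  calc _ = 𝟙 _ ⊗≫ ((𝟙_ V) ◁ ε_ D (𝟙_ V) ≫ η_ D (𝟙_ V) ▷ (𝟙_ V)) ⊗≫ 𝟙 _ := by
        monoidal
    _ = 𝟙 _ ⊗≫ (η_ D (𝟙_ V) ▷ D ≫ (α_ _ _ _).hom ≫ D ◁ ε_ D (𝟙_ V)) ⊗≫ 𝟙 _ := by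
        rw [whisker_exchange]; monoidal
    _ = _ := by
        rw [ExactPairing.evaluation_coevaluation]; monoidal

/-- Right multiplication by an element. -/
def rightMul {A : V} [MonObj A] (a : 𝟙_ V ⟶ A) : A ⟶ A := (ρ_ A).inv ≫ A ◁ a ≫ μ[A]

theorem IsCentral.comp_left {A : V} [MonObj A] {z : A ⟶ A} (hz : IsCentral z) :
    (z ≫ z) ▷ A ≫ μ[A] = μ[A] ≫ z ≫ z := by
  rw [comp_whiskerRight, Category.assoc, hz.left, reassoc_of% hz.left]

theorem IsCentral.comp_right {A : V} [MonObj A] {z : A ⟶ A} (hz : IsCentral z) :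
    A ◁ (z ≫ z) ≫ μ[A] = μ[A] ≫ z ≫ z := by
  rw [whiskerLeft_comp, Category.assoc, hz.right, reassoc_of% hz.right]

section Rigid

variable [LeftRigidCategory V]

/-- Uncurrying along the chosen dual of `B` is injective. -/
theorem uncurry_injective {X B Z : V} {S T : X ⟶ (ᘁB : V) ⊗ Z}
    (h : B ◁ S ≫ (α_ _ _ _).inv ≫ ε_ (ᘁB : V) B ▷ Z = B ◁ T ≫ (α_ _ _ _).inv ≫ ε_ (ᘁB : V) B ▷ Z) :
    S = T := by
  have key : ∀ S : X ⟶ (ᘁB : V) ⊗ Z, S = (λ_ X).inv ≫ η_ (ᘁB : V) B ▷ X ≫ (α_ _ _ _).hom ≫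
      (ᘁB : V) ◁ (B ◁ S ≫ (α_ _ _ _).inv ≫ ε_ (ᘁB : V) B ▷ Z) ≫ (ᘁB : V) ◁ (λ_ Z).hom := by
    intro S
    symm
    calc _ = 𝟙 _ ⊗≫ (η_ (ᘁB : V) B ▷ X ≫ ((ᘁB : V) ⊗ B) ◁ S) ⊗≫ (ᘁB : V) ◁ ε_ (ᘁB : V) B ▷ Z ⊗≫
          𝟙 _ := by
          monoidal
      _ = S ⊗≫ (η_ (ᘁB : V) B ▷ (ᘁB : V) ⊗≫ (ᘁB : V) ◁ ε_ (ᘁB : V) B) ▷ Z ⊗≫ 𝟙 _ := by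
          rw [← whisker_exchange]; monoidal
      _ = S := by
          rw [ExactPairing.evaluation_coevaluation'']; monoidal
  rw [key S, key T, h]

theorem whiskerLeft_action (A : V) [MonObj A] :
    A ◁ action A ≫ (α_ _ _ _).inv ≫ ε_ (ᘁA : V) A ▷ A = μ[A] ≫ (λ_ A).inv := by
  calc _ = 𝟙 _ ⊗≫ A ◁ η_ (ᘁA : V) A ▷ A ⊗≫ ((A ⊗ (ᘁA : V)) ◁ μ[A] ≫ ε_ (ᘁA : V) A ▷ A) := by
        simp only [action]; monoidal
    _ = 𝟙 _ ⊗≫ (A ◁ η_ (ᘁA : V) A ⊗≫ ε_ (ᘁA : V) A ▷ A) ▷ A ⊗≫ 𝟙_ V ◁ μ[A] := by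
        rw [whisker_exchange]; monoidal
    _ = _ := by
        rw [ExactPairing.coevaluation_evaluation'']; monoidal

theorem action_tensorUnit :
    -- This selects the chosen dual of `I`, which need not be `I` itself.
    letI : HasLeftDual (𝟙_ V) := LeftRigidCategory.leftDual (𝟙_ V)
    action (𝟙_ V) = η_ (ᘁ(𝟙_ V) : V) (𝟙_ V) := by
  have : μ[𝟙_ V] = (λ_ (𝟙_ V)).hom := rfl
  rw [action, this]
  monoidal

/-- Multiplying by `action c` in the matrix algebra touches only the `C` leg; the `C*` leg is idle.
-/
theorem whiskerLeft_action_pantsMul (C : V) [MonObj C] :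
    ((ᘁC : V) ⊗ C) ◁ action C ≫ pantsMul C = (α_ _ _ _).hom ≫ (ᘁC : V) ◁ μ[C] := by
  calc _ = 𝟙 _ ⊗≫ (ᘁC : V) ◁ (C ◁ action C ≫ (α_ _ _ _).inv ≫ ε_ (ᘁC : V) C ▷ C) ⊗≫ 𝟙 _ := by
        simp only [pantsMul]; monoidal
    _ = _ := by rw [whiskerLeft_action]; monoidal

/-- The action is multiplicative. -/
theorem mul_action (C : V) [MonObj C] : μ[C] ≫ action C = (action C ⊗ₘ action C) ≫ pantsMul C := by
  calc _ = 𝟙 _ ⊗≫ (𝟙_ V ◁ μ[C] ≫ η_ (ᘁC : V) C ▷ C) ⊗≫ (ᘁC : V) ◁ μ[C] := by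
        simp only [action]; monoidal
    _ = 𝟙 _ ⊗≫ η_ (ᘁC : V) C ▷ (C ⊗ C) ⊗≫ (ᘁC : V) ◁ ((α_ _ _ _).hom ≫ C ◁ μ[C] ≫ μ[C]) := by
        rw [whisker_exchange]; monoidal
    _ = action C ▷ C ≫ (α_ _ _ _).hom ≫ (ᘁC : V) ◁ μ[C] := by
        rw [← mul_assoc]; simp only [action]; monoidal
    _ = _ := by
        rw [← whiskerLeft_action_pantsMul, MonoidalCategory.tensorHom_def, Category.assoc]

/-- The action as a map into the abstract matrix algebra. -/
def actionHom (C : V) [MonObj C] : C ⟶ MatrixAlg C := action C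

theorem mul_actionHom (C : V) [MonObj C] :
    μ[C] ≫ actionHom C = (actionHom C ⊗ₘ actionHom C) ≫ μ[MatrixAlg C] := mul_action C

end Rigid

/-! ### Symmetry identities: cyclicity of the trace and products of algebras. -/

section Symmetric

variable [SymmetricCategory V]

theorem braiding_cyclic (X Y Z : V) :
    (β_ X (Y ⊗ Z)).hom ≫ (α_ _ _ _).hom ≫ (β_ Y (Z ⊗ X)).hom =
      (α_ _ _ _).inv ≫ (β_ (X ⊗ Y) Z).hom ≫ (α_ _ _ _).inv := by
  rw [BraidedCategory.braiding_tensor_right_hom Y Z X, Iso.hom_inv_id_assoc,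
    ← BraidedCategory.braiding_naturality_right_assoc]
  simp only [BraidedCategory.braiding_tensor_left_hom, BraidedCategory.braiding_tensor_right_hom,
    Category.assoc, Iso.inv_hom_id_assoc, ← whiskerLeft_comp_assoc, SymmetricCategory.symmetry]
  simp

theorem braiding_reverse (X Y Z : V) :
    (β_ X (Y ⊗ Z)).hom ≫ (α_ Y Z X).hom ≫ Y ◁ (β_ Z X).hom ≫ (β_ Y (X ⊗ Z)).hom =
      X ◁ (β_ Y Z).hom ≫ (α_ X Z Y).inv := by
  simp only [BraidedCategory.braiding_tensor_right_hom, Category.assoc, Iso.inv_hom_id_assoc,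
    Iso.hom_inv_id_assoc, ← whiskerLeft_comp_assoc, ← comp_whiskerRight_assoc,
    SymmetricCategory.symmetry, whiskerLeft_id, id_whiskerRight, Category.id_comp]

theorem pantsMul_trace (P Q R S : V) [ExactPairing P S] [ExactPairing R Q] :
    (α_ P Q (R ⊗ S)).hom ≫ P ◁ ((α_ Q R S).inv ≫ ε_ R Q ▷ S ≫ (λ_ S).hom) ≫
      (β_ P S).hom ≫ ε_ P S =
    (α_ _ _ _).hom ≫ P ◁ (α_ _ _ _).inv ≫ (β_ P ((Q ⊗ R) ⊗ S)).hom ≫ (α_ _ _ _).hom ≫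
      (ε_ R Q ⊗ₘ ε_ P S) ≫ (λ_ _).hom := by
  have h := BraidedCategory.braiding_naturality_right P (ε_ R Q ▷ S ≫ (λ_ S).hom)
  rw [whiskerLeft_comp, Category.assoc, reassoc_of% h, MonoidalCategory.tensorHom_def]
  monoidal

/-- Cyclicity of the trace for rectangular matrices: both traces are the same pair of caps on a
cyclic rotation of `P, Q, R, S`. -/
theorem pantsMul_trace_symm (P Q R S : V) [ExactPairing P S] [ExactPairing R Q] :
    (β_ (P ⊗ Q) (R ⊗ S)).hom ≫ (α_ R S (P ⊗ Q)).hom ≫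
      R ◁ ((α_ S P Q).inv ≫ ε_ P S ▷ Q ≫ (λ_ Q).hom) ≫ (β_ R Q).hom ≫ ε_ R Q =
    (α_ P Q (R ⊗ S)).hom ≫ P ◁ ((α_ Q R S).inv ≫ ε_ R Q ▷ S ≫ (λ_ S).hom) ≫
      (β_ P S).hom ≫ ε_ P S := by
  have h1 : (ε_ R Q ⊗ₘ ε_ P S) ≫ (λ_ _).hom =
      (β_ (Q ⊗ R) (S ⊗ P)).hom ≫ (ε_ P S ⊗ₘ ε_ R Q) ≫ (λ_ _).hom := by
    rw [← BraidedCategory.braiding_naturality_assoc, braiding_leftUnitor, unitors_equal]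
  have h2 : (R ◁ (α_ S P Q).inv) ≫ (β_ R ((S ⊗ P) ⊗ Q)).hom =
      (β_ R (S ⊗ P ⊗ Q)).hom ≫ (α_ S P Q).inv ▷ R := BraidedCategory.braiding_naturality_right _ _
  have h3 : (α_ P Q R).inv ▷ S ≫ (β_ ((P ⊗ Q) ⊗ R) S).hom =
      (β_ (P ⊗ (Q ⊗ R)) S).hom ≫ S ◁ (α_ P Q R).inv := BraidedCategory.braiding_naturality_left _ _
  rw [pantsMul_trace, pantsMul_trace, h1, reassoc_of% h2,
    reassoc_of% braiding_cyclic P (Q ⊗ R) S, reassoc_of% braiding_cyclic (P ⊗ Q) R S]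
  have h4 : (α_ (P ⊗ Q) R S).inv = (α_ P Q (R ⊗ S)).hom ≫ P ◁ (α_ Q R S).inv ≫
      (α_ P (Q ⊗ R) S).inv ≫ (α_ P Q R).inv ▷ S := by monoidal
  rw [h4]
  simp only [Category.assoc, reassoc_of% h3]
  monoidal

/-- Multiplication on the first factor, crossing the second tensor factor `D ⊗ C`. -/
theorem crossing_mul (A D C : V) [MonObj A] :
    ((α_ A (D ⊗ C) A).hom ≫ A ◁ (β_ (D ⊗ C) A).hom ≫ (α_ A A (D ⊗ C)).inv ≫ μ[A] ▷ (D ⊗ C)) ≫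
      (α_ A D C).inv ≫ (β_ A D).hom ▷ C =
    𝟙 _ ⊗≫ (β_ A D).hom ▷ (C ⊗ A) ⊗≫ D ◁ A ◁ (β_ C A).hom ⊗≫ D ◁ μ[A] ▷ C ⊗≫ 𝟙 _ := by
  calc _ = 𝟙 _ ⊗≫ A ◁ (β_ (D ⊗ C) A).hom ⊗≫ (μ[A] ▷ D ≫ (β_ A D).hom) ▷ C := by monoidal
    _ = 𝟙 _ ⊗≫ A ◁ D ◁ (β_ C A).hom ⊗≫ A ◁ ((β_ D A).hom ≫ (β_ A D).hom) ▷ C ⊗≫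
          (β_ A D).hom ▷ (A ⊗ C) ⊗≫ D ◁ μ[A] ▷ C ⊗≫ 𝟙 _ := by
        rw [BraidedCategory.braiding_naturality_left, BraidedCategory.braiding_tensor_left_hom,
          BraidedCategory.braiding_tensor_left_hom]
        monoidal
    _ = 𝟙 _ ⊗≫ ((A ⊗ D) ◁ (β_ C A).hom ≫ (β_ A D).hom ▷ (A ⊗ C)) ⊗≫ D ◁ μ[A] ▷ C ⊗≫ 𝟙 _ := by
        -- The factor `A` crosses `D` and then crosses back, so these two crossings cancel.
        rw [SymmetricCategory.symmetry]; monoidal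
    _ = _ := by
        rw [whisker_exchange]; monoidal

theorem rightMul_comp_whiskerLeft {B C C' : V} [MonObj B] [MonObj C] [MonObj C'] {g : C ⟶ C'}
    (hg : μ[C] ≫ g = (g ⊗ₘ g) ≫ μ[C']) (p : 𝟙_ V ⟶ B ⊗ C) :
    B ◁ g ≫ rightMul (p ≫ B ◁ g) = rightMul p ≫ B ◁ g := by
  have hmul : ∀ D : V, ∀ [MonObj D], μ[B ⊗ D] = tensorμ B D B D ≫ (μ[B] ⊗ₘ μ[D]) := fun D _ => rfl
  have h1 : (μ[B] ⊗ₘ μ[C]) ≫ B ◁ g = ((𝟙 B ⊗ₘ 𝟙 B) ⊗ₘ (g ⊗ₘ g)) ≫ (μ[B] ⊗ₘ μ[C']) := by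
    rw [← id_tensorHom, tensorHom_comp_tensorHom, hg, tensorHom_comp_tensorHom]; simp
  calc _ = (ρ_ (B ⊗ C)).inv ≫ ((B ◁ g) ▷ 𝟙_ V ≫ (B ⊗ C') ◁ p) ≫ (B ⊗ C') ◁ (B ◁ g) ≫ μ[B ⊗ C'] := by
        rw [rightMul]; monoidal
    _ = (ρ_ _).inv ≫ (B ⊗ C) ◁ p ≫ ((𝟙 B ⊗ₘ g) ⊗ₘ (𝟙 B ⊗ₘ g)) ≫ μ[B ⊗ C'] := by
        rw [MonoidalCategory.tensorHom_def (𝟙 B ⊗ₘ g) (𝟙 B ⊗ₘ g)]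
        simp only [id_tensorHom]
        rw [← whisker_exchange]; monoidal
    _ = _ := by
        rw [hmul, tensorμ_natural_assoc, ← h1, rightMul, hmul]; simp only [Category.assoc]

theorem IsCentral.rightMul_comp {B C : V} [MonObj B] [MonObj C] {z : C ⟶ C} (hz : IsCentral z)
    (p : 𝟙_ V ⟶ B ⊗ C) : B ◁ z ≫ rightMul p = rightMul p ≫ B ◁ z := by
  have hmul : μ[B ⊗ C] = tensorμ B C B C ≫ (μ[B] ⊗ₘ μ[C]) := rfl
  have h1 : (μ[B] ⊗ₘ μ[C]) ≫ B ◁ z = ((𝟙 B ⊗ₘ 𝟙 B) ⊗ₘ (z ⊗ₘ 𝟙 C)) ≫ (μ[B] ⊗ₘ μ[C]) := by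
    rw [← id_tensorHom, tensorHom_comp_tensorHom, ← hz.left, tensorHom_comp_tensorHom]; simp
  calc _ = (ρ_ (B ⊗ C)).inv ≫ ((B ◁ z) ▷ 𝟙_ V ≫ (B ⊗ C) ◁ p) ≫ μ[B ⊗ C] := by
        rw [rightMul]; monoidal
    _ = (ρ_ _).inv ≫ (B ⊗ C) ◁ p ≫ ((𝟙 B ⊗ₘ z) ⊗ₘ (𝟙 B ⊗ₘ 𝟙 C)) ≫ μ[B ⊗ C] := by
        rw [← whisker_exchange]; simp
    _ = _ := by
        rw [hmul, tensorμ_natural_assoc, ← h1, rightMul, hmul]; simp only [Category.assoc]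

end Symmetric

section RigidSymmetric

variable [SymmetricCategory V] [LeftRigidCategory V]

/-- The symmetry moving the dual leg of a matrix algebra to the front. -/
def shuffle (A C : V) : A ⊗ ((ᘁC : V) ⊗ C) ⟶ (ᘁC : V) ⊗ (A ⊗ C) :=
  (α_ _ _ _).inv ≫ (β_ A (ᘁC : V)).hom ▷ C ≫ (α_ _ _ _).hom

/-- The bracket on the left is right multiplication by `p ≫ A ◁ actionHom C` written out. By
`whiskerLeft_action_pantsMul` it fixes the `C*` leg, which can be carried to the front. -/
theorem tensor_mul_action_shuffle {A C : V} [MonObj A] [MonObj C] (p : 𝟙_ V ⟶ A ⊗ C) :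
    ((ρ_ (A ⊗ ((ᘁC : V) ⊗ C))).inv ≫ (A ⊗ ((ᘁC : V) ⊗ C)) ◁ (p ≫ A ◁ action C) ≫
        tensorμ A ((ᘁC : V) ⊗ C) A ((ᘁC : V) ⊗ C) ≫ (μ[A] ⊗ₘ pantsMul C)) ≫ shuffle A C =
      shuffle A C ≫ (ᘁC : V) ◁ rightMul p := by
  let W : (A ⊗ ((ᘁC : V) ⊗ C)) ⊗ A ⟶ A ⊗ ((ᘁC : V) ⊗ C) :=
    (α_ A ((ᘁC : V) ⊗ C) A).hom ≫ A ◁ (β_ ((ᘁC : V) ⊗ C) A).hom ≫ (α_ A A ((ᘁC : V) ⊗ C)).inv ≫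
      μ[A] ▷ ((ᘁC : V) ⊗ C)
  have hW : W ≫ (α_ A (ᘁC : V) C).inv ≫ (β_ A (ᘁC : V)).hom ▷ C = _ := crossing_mul A (ᘁC : V) C
  have hp : rightMul p = (ρ_ (A ⊗ C)).inv ≫ (A ⊗ C) ◁ p ≫ tensorμ A C A C ≫ (μ[A] ⊗ₘ μ[C]) := rfl
  calc _ = 𝟙 _ ⊗≫ (A ⊗ ((ᘁC : V) ⊗ C)) ◁ p ⊗≫
            (((A ⊗ ((ᘁC : V) ⊗ C)) ⊗ A) ◁ action C ≫ W ▷ ((ᘁC : V) ⊗ C)) ⊗≫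
            A ◁ pantsMul C ⊗≫ (β_ A (ᘁC : V)).hom ▷ C ⊗≫ 𝟙 _ := by
        rw [MonoidalCategory.tensorHom_def, shuffle]
        simp only [tensorμ, W]
        monoidal
    _ = 𝟙 _ ⊗≫ (A ⊗ ((ᘁC : V) ⊗ C)) ◁ p ⊗≫ W ▷ C ⊗≫
            A ◁ (((ᘁC : V) ⊗ C) ◁ action C ≫ pantsMul C) ⊗≫ (β_ A (ᘁC : V)).hom ▷ C ⊗≫ 𝟙 _ := by
        rw [whisker_exchange]; monoidal
    _ = 𝟙 _ ⊗≫ (A ⊗ ((ᘁC : V) ⊗ C)) ◁ p ⊗≫ W ▷ C ⊗≫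
            ((A ⊗ (ᘁC : V)) ◁ μ[C] ≫ (β_ A (ᘁC : V)).hom ▷ C) ⊗≫ 𝟙 _ := by
        rw [whiskerLeft_action_pantsMul]; monoidal
    _ = 𝟙 _ ⊗≫ (A ⊗ ((ᘁC : V) ⊗ C)) ◁ p ⊗≫
            (W ≫ (α_ A (ᘁC : V) C).inv ≫ (β_ A (ᘁC : V)).hom ▷ C) ▷ C ⊗≫
            ((ᘁC : V) ⊗ A) ◁ μ[C] ⊗≫ 𝟙 _ := by
        rw [whisker_exchange]; monoidal
    _ = 𝟙 _ ⊗≫ ((A ⊗ (ᘁC : V)) ◁ (C ◁ p) ≫ (β_ A (ᘁC : V)).hom ▷ (C ⊗ (A ⊗ C))) ⊗≫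
            (ᘁC : V) ◁ A ◁ (β_ C A).hom ▷ C ⊗≫ (ᘁC : V) ◁ μ[A] ▷ (C ⊗ C) ⊗≫
            ((ᘁC : V) ⊗ A) ◁ μ[C] ⊗≫ 𝟙 _ := by
        rw [hW]; monoidal
    _ = _ := by
        rw [whisker_exchange, hp, MonoidalCategory.tensorHom_def, shuffle]
        simp only [tensorμ]
        monoidal

end RigidSymmetric

end Monoidal

/-! ### Daggers of the structure maps, and positive maps. -/

section DaggerCompact

variable {V : Type u} [Category.{v} V] [MonoidalCategory V] [SymmetricCategory V]
  [LeftRigidCategory V] [DaggerCompactCategory V]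

attribute [simp] DaggerCategory.dag_id DaggerCategory.dag_comp DaggerCategory.dag_dag

theorem dag_whiskerLeft (X : V) {Y Z : V} (f : Y ⟶ Z) : dag (X ◁ f) = X ◁ dag f := by
  rw [← id_tensorHom, DaggerCompactCategory.dag_tensorHom, dag_id, id_tensorHom]

theorem dag_whiskerRight {Y Z : V} (f : Y ⟶ Z) (X : V) : dag (f ▷ X) = dag f ▷ X := by
  rw [← tensorHom_id, DaggerCompactCategory.dag_tensorHom, dag_id, tensorHom_id]

theorem dag_associator_hom (X Y Z : V) : dag (α_ X Y Z).hom = (α_ X Y Z).inv :=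
  DaggerCompactCategory.dag_associator X Y Z

theorem dag_associator_inv (X Y Z : V) : dag (α_ X Y Z).inv = (α_ X Y Z).hom := by
  rw [← dag_associator_hom, dag_dag]

theorem dag_leftUnitor_hom (X : V) : dag (λ_ X).hom = (λ_ X).inv :=
  DaggerCompactCategory.dag_leftUnitor X

theorem dag_leftUnitor_inv (X : V) : dag (λ_ X).inv = (λ_ X).hom := by
  rw [← dag_leftUnitor_hom, dag_dag]

theorem dag_braiding_hom (X Y : V) : dag (β_ X Y).hom = (β_ Y X).hom := by
  rw [DaggerCompactCategory.dag_braiding, ← SymmetricCategory.braiding_swap_eq_inv_braiding]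

theorem dag_rightUnitor_hom (X : V) : dag (ρ_ X).hom = (ρ_ X).inv := by
  rw [← braiding_leftUnitor, dag_comp, dag_leftUnitor_hom, dag_braiding_hom,
    leftUnitor_inv_braiding]

theorem dag_rightUnitor_inv (X : V) : dag (ρ_ X).inv = (ρ_ X).hom := by
  rw [← dag_rightUnitor_hom, dag_dag]

attribute [simp] dag_whiskerLeft dag_whiskerRight dag_associator_hom dag_associator_inv
  dag_leftUnitor_hom dag_leftUnitor_inv dag_rightUnitor_hom dag_rightUnitor_inv dag_braiding_hom
  DaggerCompactCategory.dag_tensorHom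

/-- The dagger of the cup is the cap precomposed with the symmetry. -/
theorem dag_coevaluation (X : V) : dag (η_ (ᘁX : V) X) = (β_ (ᘁX : V) X).hom ≫ ε_ (ᘁX : V) X := by
  rw [← DaggerCompactCategory.dag_evaluation, dag_comp, dag_dag, dag_braiding_hom]

theorem dag_evaluation_eq (X : V) : dag (ε_ (ᘁX : V) X) = η_ (ᘁX : V) X ≫ (β_ (ᘁX : V) X).hom := by
  rw [← DaggerCompactCategory.dag_evaluation, Category.assoc, SymmetricCategory.symmetry,
    Category.comp_id]

/-- The daggers of the cap and the cup satisfy a snake equation. -/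
theorem dag_evaluation_coevaluation (X : V) :
    dag (ε_ (ᘁX : V) X) ▷ X ≫ (α_ _ _ _).hom ≫ X ◁ dag (η_ (ᘁX : V) X) =
      (λ_ X).hom ≫ (ρ_ X).inv := by
  have := congrArg dag (ExactPairing.coevaluation_evaluation (ᘁX : V) X)
  simpa only [dag_comp, dag_whiskerLeft, dag_whiskerRight, dag_associator_inv,
    dag_rightUnitor_hom, dag_leftUnitor_inv, Category.assoc] using this

theorem isPositiveMap_sandwich {X Y : V} (h : X ⟶ Y) {P : Y ⟶ Y} (hP : IsPositiveMap P) :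
    IsPositiveMap (h ≫ P ≫ dag h) := by
  obtain ⟨Z, k, rfl⟩ := hP
  exact ⟨Z, h ≫ k, by simp⟩

theorem isPositiveMap_whiskerLeft (W : V) {Y : V} {P : Y ⟶ Y} (hP : IsPositiveMap P) :
    IsPositiveMap (W ◁ P) := by
  obtain ⟨Z, k, rfl⟩ := hP
  exact ⟨W ⊗ Z, W ◁ k, by simp⟩

/-! ### The CP*-condition as a Stinespring form. -/

/-- A Kraus map `A ⟶ X ⊗ B` bent to a map `B ⟶ X* ⊗ A`. -/
def bendKraus {A X B : V} (g : A ⟶ X ⊗ B) : B ⟶ (ᘁX : V) ⊗ A :=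
  (λ_ B).inv ≫ η_ (ᘁX : V) X ▷ B ≫ (α_ _ _ _).hom ≫ (ᘁX : V) ◁ dag g

/-- The uncurried Kraus form of a map `B ⟶ Y ⊗ A`. -/
def stinespringForm {A Y B : V} (k : B ⟶ Y ⊗ A) : B ⊗ ((ᘁA : V) ⊗ A) ⟶ B :=
  k ▷ ((ᘁA : V) ⊗ A) ≫ (α_ _ _ _).hom ≫ Y ◁ ((α_ _ _ _).inv ≫ ε_ (ᘁA : V) A ▷ A ≫ (λ_ A).hom) ≫
      dag k

theorem whiskerLeft_lowerStar {A X B : V} (g : A ⟶ X ⊗ B) :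
    B ◁ (lowerStar g : (ᘁA : V) ⟶ (ᘁB : V) ⊗ (ᘁX : V)) ≫ (α_ _ _ _).inv ≫
      ε_ (ᘁB : V) B ▷ (ᘁX : V) =
    bendKraus g ▷ (ᘁA : V) ≫ (α_ _ _ _).hom ≫ (ᘁX : V) ◁ ε_ (ᘁA : V) A ≫ (ρ_ _).hom ≫
        (λ_ _).inv := by
  calc _ = 𝟙 _ ⊗≫ B ◁ η_ (ᘁB : V) B ▷ (ᘁA : V) ⊗≫
            (B ⊗ (ᘁB : V)) ◁ (η_ (ᘁX : V) X ▷ B ▷ (ᘁA : V) ⊗≫ (ᘁX : V) ◁ dag g ▷ (ᘁA : V) ⊗≫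
              (ᘁX : V) ◁ ε_ (ᘁA : V) A ⊗≫ 𝟙 _) ≫ ε_ (ᘁB : V) B ▷ (ᘁX : V) := by
        -- The dual of `X ⊗ B` is `B* ⊗ X*`, so its cup is a pair of nested cups; the outer one then
        -- straightens against the cap on `B`.
        simp only [lowerStar, ExactPairing.tensor_coevaluation]; monoidal
    _ = 𝟙 _ ⊗≫ (B ◁ η_ (ᘁB : V) B ⊗≫ ε_ (ᘁB : V) B ▷ B) ▷ (ᘁA : V) ⊗≫
            (η_ (ᘁX : V) X ▷ B ▷ (ᘁA : V) ⊗≫ (ᘁX : V) ◁ dag g ▷ (ᘁA : V) ⊗≫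
              (ᘁX : V) ◁ ε_ (ᘁA : V) A ⊗≫ 𝟙 _) := by
        rw [whisker_exchange]; monoidal
    _ = _ := by
        rw [ExactPairing.coevaluation_evaluation'']; simp only [bendKraus]; monoidal

theorem whiskerLeft_krausForm {A X B : V} (g : A ⟶ X ⊗ B) :
    B ◁ krausForm g ≫ (α_ _ _ _).inv ≫ ε_ (ᘁB : V) B ▷ B =
      stinespringForm (bendKraus g) ≫ (λ_ B).inv := by
  have hk : dag (bendKraus g) =
      (ᘁX : V) ◁ g ≫ (α_ _ _ _).inv ≫ dag (η_ (ᘁX : V) X) ▷ B ≫ (λ_ B).hom := by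
    simp [bendKraus]
  calc _ = 𝟙 _ ⊗≫ B ◁ (lowerStar g : (ᘁA : V) ⟶ (ᘁB : V) ⊗ (ᘁX : V)) ▷ A ⊗≫
            B ◁ (ᘁB : V) ◁ (ᘁX : V) ◁ g ⊗≫
            ((B ⊗ (ᘁB : V)) ◁ (dag (η_ (ᘁX : V) X) ▷ B) ≫ ε_ (ᘁB : V) B ▷ (𝟙_ V ⊗ B)) ⊗≫ 𝟙 _ := by
        simp only [krausForm, MonoidalCategory.tensorHom_def]; monoidal
    _ = 𝟙 _ ⊗≫ B ◁ (lowerStar g : (ᘁA : V) ⟶ (ᘁB : V) ⊗ (ᘁX : V)) ▷ A ⊗≫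
            ((B ⊗ (ᘁB : V)) ◁ ((ᘁX : V) ◁ g) ≫ ε_ (ᘁB : V) B ▷ ((ᘁX : V) ⊗ (X ⊗ B))) ⊗≫
            (dag (η_ (ᘁX : V) X) ▷ B) ⊗≫ 𝟙 _ := by
        rw [whisker_exchange]; monoidal
    _ = 𝟙 _ ⊗≫ (B ◁ (lowerStar g : (ᘁA : V) ⟶ (ᘁB : V) ⊗ (ᘁX : V)) ≫ (α_ _ _ _).inv ≫
            ε_ (ᘁB : V) B ▷ (ᘁX : V)) ▷ A ⊗≫ (ᘁX : V) ◁ g ⊗≫ (dag (η_ (ᘁX : V) X) ▷ B) ⊗≫ 𝟙 _ := by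
        rw [whisker_exchange]; monoidal
    _ = _ := by
        rw [whiskerLeft_lowerStar, stinespringForm, hk]; monoidal

/-- The canonical map from an object to its double dual. -/
def toDoubleDual (Y : V) : Y ⟶ (ᘁ(ᘁY : V) : V) :=
  (λ_ Y).inv ≫ η_ (ᘁ(ᘁY : V) : V) (ᘁY : V) ▷ Y ≫ (α_ _ _ _).hom ≫
    (ᘁ(ᘁY : V) : V) ◁ dag (η_ (ᘁY : V) Y) ≫ (ρ_ _).hom

/-- The dagger of this second formula is built from the caps and cups that snake against those of
the first, which makes the map an isometry. -/
theorem toDoubleDual_eq (Y : V) :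
    toDoubleDual Y = (ρ_ Y).inv ≫ Y ◁ dag (ε_ (ᘁ(ᘁY : V) : V) (ᘁY : V)) ≫ (α_ _ _ _).inv ≫
      ε_ (ᘁY : V) Y ▷ (ᘁ(ᘁY : V) : V) ≫ (λ_ _).hom := by
  have h1 : (ρ_ Y).inv ≫ Y ◁ η_ (ᘁ(ᘁY : V) : V) (ᘁY : V) =
      (λ_ Y).inv ≫ η_ (ᘁ(ᘁY : V) : V) (ᘁY : V) ▷ Y ≫ (β_ _ _).hom := by
    rw [BraidedCategory.braiding_naturality_left, leftUnitor_inv_braiding_assoc]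
  have h2 : (ᘁ(ᘁY : V) : V) ◁ ε_ (ᘁY : V) Y ≫ (ρ_ _).hom =
      (β_ _ _).hom ≫ ε_ (ᘁY : V) Y ▷ (ᘁ(ᘁY : V) : V) ≫ (λ_ _).hom := by
    rw [← BraidedCategory.braiding_naturality_right_assoc, braiding_leftUnitor]
  rw [toDoubleDual, dag_coevaluation, dag_evaluation_eq, whiskerLeft_comp, whiskerLeft_comp,
    Category.assoc, Category.assoc, reassoc_of% h1, h2]
  simp [BraidedCategory.braiding_tensor_left_hom, BraidedCategory.braiding_tensor_right_hom]

theorem toDoubleDual_comp_dag (Y : V) : toDoubleDual Y ≫ dag (toDoubleDual Y) = 𝟙 Y := by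
  have h : dag (toDoubleDual Y) = (λ_ _).inv ≫ dag (ε_ (ᘁY : V) Y) ▷ (ᘁ(ᘁY : V) : V) ≫
      (α_ _ _ _).hom ≫ Y ◁ ε_ (ᘁ(ᘁY : V) : V) (ᘁY : V) ≫ (ρ_ Y).hom := by
    rw [toDoubleDual_eq]; simp
  calc _ = 𝟙 _ ⊗≫ η_ (ᘁ(ᘁY : V) : V) (ᘁY : V) ▷ Y ⊗≫
            (𝟙_ V ◁ (ᘁ(ᘁY : V) : V) ◁ dag (η_ (ᘁY : V) Y) ≫
              dag (ε_ (ᘁY : V) Y) ▷ ((ᘁ(ᘁY : V) : V) ⊗ 𝟙_ V)) ⊗≫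
              Y ◁ ε_ (ᘁ(ᘁY : V) : V) (ᘁY : V) ⊗≫ 𝟙 _ := by
        rw [h, toDoubleDual]; monoidal
    _ = 𝟙 _ ⊗≫ (𝟙_ V ◁ η_ (ᘁ(ᘁY : V) : V) (ᘁY : V) ≫ dag (ε_ (ᘁY : V) Y) ▷ _) ▷ Y ⊗≫
            Y ◁ ((ᘁY : V) ⊗ (ᘁ(ᘁY : V) : V)) ◁ dag (η_ (ᘁY : V) Y) ⊗≫
              Y ◁ ε_ (ᘁ(ᘁY : V) : V) (ᘁY : V) ⊗≫ 𝟙 _ := by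
        rw [whisker_exchange]; monoidal
    _ = 𝟙 _ ⊗≫ dag (ε_ (ᘁY : V) Y) ▷ Y ⊗≫
            Y ◁ (ᘁY : V) ◁ η_ (ᘁ(ᘁY : V) : V) (ᘁY : V) ▷ Y ⊗≫
            Y ◁ (((ᘁY : V) ⊗ (ᘁ(ᘁY : V) : V)) ◁ dag (η_ (ᘁY : V) Y) ≫
              ε_ (ᘁ(ᘁY : V) : V) (ᘁY : V) ▷ 𝟙_ V) ⊗≫ 𝟙 _ := by
        rw [whisker_exchange]; monoidal
    _ = 𝟙 _ ⊗≫ dag (ε_ (ᘁY : V) Y) ▷ Y ⊗≫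
            Y ◁ ((ᘁY : V) ◁ η_ (ᘁ(ᘁY : V) : V) (ᘁY : V) ⊗≫
              ε_ (ᘁ(ᘁY : V) : V) (ᘁY : V) ▷ (ᘁY : V)) ▷ Y ⊗≫
            Y ◁ dag (η_ (ᘁY : V) Y) ⊗≫ 𝟙 _ := by
        rw [whisker_exchange]; monoidal
    _ = 𝟙 _ ⊗≫ (dag (ε_ (ᘁY : V) Y) ▷ Y ≫ (α_ _ _ _).hom ≫ Y ◁ dag (η_ (ᘁY : V) Y)) ⊗≫ 𝟙 _ := by
        rw [ExactPairing.coevaluation_evaluation'']; monoidal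
    _ = _ := by
        rw [dag_evaluation_coevaluation]; monoidal

/-- The ancilla `Y` matters only up to isometry. This is needed because `bendKraus` produces
ancillas of the form `X*` only. -/
theorem stinespringForm_comp_whiskerRight {A Y Z B : V} (k : B ⟶ Y ⊗ A) (t : Y ⟶ Z)
    (ht : t ≫ dag t = 𝟙 Y) : stinespringForm (k ≫ t ▷ A) = stinespringForm k := by
  calc _ = 𝟙 _ ⊗≫ k ▷ ((ᘁA : V) ⊗ A) ⊗≫ (t ▷ (A ⊗ ((ᘁA : V) ⊗ A)) ≫
            Z ◁ ((α_ _ _ _).inv ≫ ε_ (ᘁA : V) A ▷ A ≫ (λ_ A).hom)) ⊗≫ dag t ▷ A ≫ dag k := by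
        simp only [stinespringForm, dag_comp, dag_whiskerRight]; monoidal
    _ = 𝟙 _ ⊗≫ k ▷ ((ᘁA : V) ⊗ A) ⊗≫
            Y ◁ ((α_ _ _ _).inv ≫ ε_ (ᘁA : V) A ▷ A ≫ (λ_ A).hom) ≫ (t ≫ dag t) ▷ A ≫ dag k := by
        rw [← whisker_exchange]; monoidal
    _ = _ := by
        rw [ht, stinespringForm]; monoidal

theorem exists_bendKraus {A Y B : V} (k : B ⟶ Y ⊗ A) :
    ∃ g : A ⟶ (ᘁY : V) ⊗ B, bendKraus g = k ≫ toDoubleDual Y ▷ A := by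
  -- The witness is `k` bent once; bending again lands in the double dual of `Y`.
  refine ⟨(λ_ A).inv ≫ η_ (ᘁY : V) Y ▷ A ≫ (α_ _ _ _).hom ≫ (ᘁY : V) ◁ dag k, ?_⟩
  calc _ = 𝟙 _ ⊗≫ (η_ (ᘁ(ᘁY : V) : V) (ᘁY : V) ▷ B ≫ _ ◁ k) ⊗≫
          (ᘁ(ᘁY : V) : V) ◁ dag (η_ (ᘁY : V) Y) ▷ A ⊗≫ 𝟙 _ := by
        simp only [bendKraus, dag_comp, dag_whiskerLeft, dag_whiskerRight, dag_dag,
          dag_associator_hom, dag_leftUnitor_inv]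
        monoidal
    _ = _ := by
        rw [← whisker_exchange, toDoubleDual]; monoidal

/-- The CP*-condition in uncurried form. -/
theorem satisfiesCPStar_iff {A B : V} [MonObj A] [MonObj B] (f : A ⟶ B) :
    SatisfiesCPStar f ↔ ∃ (Y : V) (k : B ⟶ Y ⊗ A),
      B ◁ (coaction A ≫ f) ≫ μ[B] = stinespringForm k := by
  have hf : B ◁ (coaction A ≫ f ≫ action B) ≫ (α_ _ _ _).inv ≫ ε_ (ᘁB : V) B ▷ B =
      (B ◁ (coaction A ≫ f) ≫ μ[B]) ≫ (λ_ B).inv := by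
    rw [Category.assoc, ← whiskerLeft_action, ← Category.assoc (coaction A), whiskerLeft_comp,
      Category.assoc]
  constructor
  · rintro ⟨X, g, h⟩
    refine ⟨_, bendKraus g, ?_⟩
    rw [← cancel_mono (λ_ B).inv, ← hf, h, whiskerLeft_krausForm]
  · rintro ⟨Y, k, h⟩
    obtain ⟨g, hg⟩ := exists_bendKraus k
    refine ⟨_, g, uncurry_injective ?_⟩
    rw [hf, h, whiskerLeft_krausForm, hg,
      stinespringForm_comp_whiskerRight _ _ (toDoubleDual_comp_dag Y)]

/-! ### Positive elements and dilations. -/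

theorem coaction_tensorUnit :
    letI : HasLeftDual (𝟙_ V) := LeftRigidCategory.leftDual (𝟙_ V)
    coaction (𝟙_ V) = (ρ_ _).hom ≫ (λ_ _).inv ≫ ε_ (ᘁ(𝟙_ V) : V) (𝟙_ V) := by
  rw [coaction, action_tensorUnit, dag_coevaluation, braiding_tensorUnit_right, Category.assoc]

theorem action_comp_coaction_tensorUnit : action (𝟙_ V) ≫ coaction (𝟙_ V) = 𝟙 _ := by
  rw [coaction_tensorUnit, action_tensorUnit]
  exact coevaluation_comp_evaluation_tensorUnit _

theorem coaction_comp_action_tensorUnit : coaction (𝟙_ V) ≫ action (𝟙_ V) = 𝟙 _ := by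
  rw [coaction_tensorUnit, action_tensorUnit]
  exact evaluation_comp_coevaluation_tensorUnit _

/-- Hence precomposing the CP*-condition of a map out of `I` with this action loses no information.
-/
instance isIso_action_tensorUnit : IsIso (action (𝟙_ V)) :=
  ⟨coaction _, action_comp_coaction_tensorUnit, coaction_comp_action_tensorUnit⟩

theorem whiskerLeft_action_stinespringForm {A Y B : V} [MonObj A] (k : B ⟶ Y ⊗ A) :
    B ◁ action A ≫ stinespringForm k = k ▷ A ≫ (α_ _ _ _).hom ≫ Y ◁ μ[A] ≫ dag k := by
  calc _ = (B ◁ action A ≫ k ▷ ((ᘁA : V) ⊗ A)) ⊗≫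
            Y ◁ ((α_ _ _ _).inv ≫ ε_ (ᘁA : V) A ▷ A) ⊗≫ dag k := by
        simp only [stinespringForm]; monoidal
    _ = k ▷ A ⊗≫ Y ◁ (A ◁ action A ≫ (α_ _ _ _).inv ≫ ε_ (ᘁA : V) A ▷ A) ⊗≫ dag k := by
        rw [whisker_exchange]; monoidal
    _ = _ := by
        rw [whiskerLeft_action]; monoidal

/-- An element is positive exactly when right multiplication by it is a positive map. -/
theorem isPositiveElement_iff {A : V} [MonObj A] (a : 𝟙_ V ⟶ A) :
    IsPositiveElement a ↔ IsPositiveMap (rightMul a) := by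
  have hμ : μ[𝟙_ V] = (λ_ (𝟙_ V)).hom := rfl
  have h1 : A ◁ action (𝟙_ V) ≫ A ◁ (coaction (𝟙_ V) ≫ a) ≫ μ[A] = (ρ_ A).hom ≫ rightMul a := by
    rw [← whiskerLeft_comp_assoc, ← Category.assoc (action _), action_comp_coaction_tensorUnit,
      Category.id_comp, rightMul, Iso.hom_inv_id_assoc]
  have h2 : ∀ {Y : V} (k : A ⟶ Y ⊗ 𝟙_ V), A ◁ action (𝟙_ V) ≫ stinespringForm k =
      (ρ_ A).hom ≫ k ≫ dag k := by
    intro Y k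
    rw [whiskerLeft_action_stinespringForm, hμ, ← rightUnitor_naturality_assoc]
    monoidal
  rw [IsPositiveElement, satisfiesCPStar_iff]
  constructor
  · rintro ⟨Y, k, h⟩
    refine ⟨_, k, ?_⟩
    rw [← cancel_epi (ρ_ A).hom, ← h1, h, h2]
  · rintro ⟨Y, k, h⟩
    refine ⟨Y, k ≫ (ρ_ Y).inv, ?_⟩
    have h3 : A ◁ action (𝟙_ V) ≫ A ◁ (coaction (𝟙_ V) ≫ a) ≫ μ[A] =
        A ◁ action (𝟙_ V) ≫ stinespringForm (k ≫ (ρ_ Y).inv) := by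
      rw [h1, h2, h]; simp
    exact (cancel_epi (A ◁ action (𝟙_ V))).1 h3

/-- A Stinespring-type dilation of the CP*-condition. -/
theorem exists_dilation {A B : V} [MonObj A] [MonObj B] {f : A ⟶ B} (hf : SatisfiesCPStar f)
    (z : A ⟶ A) (hz : IsCentral z) (hdag : dag z = z)
    (hact : z ≫ z ≫ action A ≫ coaction A = 𝟙 A) :
    ∃ (X : V) (k : B ⟶ X ⊗ A),
      B ◁ f ≫ μ[B] = k ▷ A ≫ (α_ _ _ _).hom ≫ X ◁ μ[A] ≫ dag k := by
  obtain ⟨X, k, hk⟩ := (satisfiesCPStar_iff f).1 hf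
  -- By centrality, the two copies of `z` in `z² ≫ action A ≫ coaction A = 1` move to either side of
  -- `μ[A]`; as `z` is self-adjoint, one is absorbed by `k` and the other by `dag k`.
  refine ⟨X, k ≫ X ◁ z, ?_⟩
  calc B ◁ f ≫ μ[B] = B ◁ (z ≫ z) ≫ B ◁ action A ≫ B ◁ (coaction A ≫ f) ≫ μ[B] := by
        conv_lhs => rw [← Category.id_comp f, ← hact]
        simp only [whiskerLeft_comp, Category.assoc]
    _ = (B ◁ (z ≫ z) ≫ k ▷ A) ⊗≫ X ◁ μ[A] ≫ dag k := by
        rw [hk, whiskerLeft_action_stinespringForm]; monoidal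
    _ = k ▷ A ⊗≫ X ◁ (A ◁ z ≫ A ◁ z ≫ μ[A]) ≫ dag k := by
        rw [whisker_exchange]; monoidal
    _ = k ▷ A ⊗≫ X ◁ (z ▷ A ≫ μ[A] ≫ z) ≫ dag k := by
        rw [hz.right, reassoc_of% hz.right, reassoc_of% hz.left]
    _ = _ := by
        simp only [dag_comp, dag_whiskerLeft, hdag]; monoidal

/-- Whiskering a dilated map preserves positive elements. -/
theorem rightMul_comp_whiskerRight {A B C X : V} [MonObj A] [MonObj B] [MonObj C] {f : A ⟶ B}
    {k : B ⟶ X ⊗ A} (hk : B ◁ f ≫ μ[B] = k ▷ A ≫ (α_ _ _ _).hom ≫ X ◁ μ[A] ≫ dag k)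
    (p : 𝟙_ V ⟶ A ⊗ C) :
    rightMul (p ≫ f ▷ C) = (k ▷ C ≫ (α_ _ _ _).hom) ≫ X ◁ rightMul p ≫ dag (k ▷ C ≫
        (α_ _ _ _).hom) := by
  have hmul : ∀ D : V, ∀ [MonObj D], μ[D ⊗ C] = tensorμ D C D C ≫ (μ[D] ⊗ₘ μ[C]) := fun D _ => rfl
  calc _ = 𝟙 _ ⊗≫ (B ⊗ C) ◁ p ⊗≫ B ◁ ((C ◁ f ≫ (β_ C B).hom) ▷ C) ⊗≫ (μ[B] ⊗ₘ μ[C]) := by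
        rw [rightMul, hmul]; simp only [tensorμ]; monoidal
    _ = 𝟙 _ ⊗≫ (B ⊗ C) ◁ p ⊗≫ B ◁ (β_ C A).hom ▷ C ⊗≫
          (B ◁ f ≫ μ[B]) ▷ (C ⊗ C) ⊗≫ B ◁ μ[C] := by
        rw [BraidedCategory.braiding_naturality_right, MonoidalCategory.tensorHom_def]; monoidal
    _ = 𝟙 _ ⊗≫ (B ⊗ C) ◁ p ⊗≫ (B ◁ ((β_ C A).hom ▷ C) ≫ k ▷ ((A ⊗ C) ⊗ C)) ⊗≫
          X ◁ μ[A] ▷ (C ⊗ C) ⊗≫ (dag k ▷ (C ⊗ C) ≫ B ◁ μ[C]) := by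
        rw [hk]; monoidal
    _ = 𝟙 _ ⊗≫ (B ◁ (C ◁ p) ≫ k ▷ (C ⊗ (A ⊗ C))) ⊗≫ (X ⊗ A) ◁ (β_ C A).hom ▷ C ⊗≫
          X ◁ μ[A] ▷ (C ⊗ C) ⊗≫ (X ⊗ A) ◁ μ[C] ⊗≫ dag k ▷ C := by
        rw [whisker_exchange, ← whisker_exchange (dag k)]; monoidal
    _ = _ := by
        rw [whisker_exchange, rightMul, hmul, MonoidalCategory.tensorHom_def]
        simp only [tensorμ, dag_comp, dag_whiskerRight, dag_associator_hom]
        monoidal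

/-! ### The Frobenius form and the normaliser. -/

/-- The Frobenius form. -/
def cap (A : V) [MonObj A] : A ⊗ A ⟶ 𝟙_ V := μ[A] ≫ counit A

/-- The dagger of the Frobenius form. -/
def cup (A : V) [MonObj A] : 𝟙_ V ⟶ A ⊗ A := η[A] ≫ comul A

section Frobenius

variable {A : V} [MonObj A]

theorem dag_mul : dag μ[A] = comul A := rfl
theorem dag_one : dag η[A] = counit A := rfl
theorem dag_counit : dag (counit A) = η[A] := dag_dag _
theorem dag_cap : dag (cap A) = cup A := by rw [cap, cup, dag_comp, dag_mul, dag_counit]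

theorem comul_counit_left : comul A ≫ counit A ▷ A = (λ_ A).inv := by
  have := congrArg dag (one_mul A)
  simpa only [dag_comp, dag_mul, dag_whiskerRight, dag_one, dag_leftUnitor_hom] using this

theorem comul_counit_right : comul A ≫ A ◁ counit A = (ρ_ A).inv := by
  have := congrArg dag (mul_one A)
  simpa only [dag_comp, dag_mul, dag_whiskerLeft, dag_one, dag_rightUnitor_hom] using this

theorem comul_eq_left (hA : IsDaggerFrobenius A) :
    comul A = (λ_ A).inv ≫ cup A ▷ A ≫ (α_ _ _ _).hom ≫ A ◁ μ[A] := by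
  rw [cup, comp_whiskerRight, Category.assoc, hA.frobenius_left, ← Category.assoc (η[A] ▷ A),
    one_mul, Iso.inv_hom_id_assoc]

theorem comul_eq_right (hA : IsDaggerFrobenius A) :
    comul A = (ρ_ A).inv ≫ A ◁ cup A ≫ (α_ _ _ _).inv ≫ μ[A] ▷ A := by
  rw [cup, whiskerLeft_comp, Category.assoc, hA.frobenius_right, ← Category.assoc (A ◁ η[A]),
    mul_one, Iso.inv_hom_id_assoc]

theorem cup_cap_left (hA : IsDaggerFrobenius A) :
    cup A ▷ A ≫ (α_ _ _ _).hom ≫ A ◁ cap A = (λ_ A).hom ≫ (ρ_ A).inv := by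
  rw [← comul_counit_right, comul_eq_left hA, cap, whiskerLeft_comp]
  simp

theorem cup_cap_right (hA : IsDaggerFrobenius A) :
    A ◁ cup A ≫ (α_ _ _ _).inv ≫ cap A ▷ A = (ρ_ A).hom ≫ (λ_ A).inv := by
  rw [← comul_counit_left, comul_eq_right hA, cap, comp_whiskerRight]
  simp

/-- The comparison of the two dualities on a Frobenius algebra. -/
def toDual (A : V) [MonObj A] : A ⟶ (ᘁA : V) :=
  (λ_ A).inv ≫ η_ (ᘁA : V) A ▷ A ≫ (α_ _ _ _).hom ≫ (ᘁA : V) ◁ cap A ≫ (ρ_ _).hom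

theorem whiskerLeft_toDual : A ◁ toDual A ≫ ε_ (ᘁA : V) A = cap A := by
  calc _ = 𝟙 _ ⊗≫ A ◁ η_ (ᘁA : V) A ▷ A ⊗≫ ((A ⊗ (ᘁA : V)) ◁ cap A ≫ ε_ (ᘁA : V) A ▷ 𝟙_ V) ⊗≫
        𝟙 _ := by
        simp only [toDual]; monoidal
    _ = 𝟙 _ ⊗≫ (A ◁ η_ (ᘁA : V) A ⊗≫ ε_ (ᘁA : V) A ▷ A) ▷ A ⊗≫ 𝟙_ V ◁ cap A ⊗≫ 𝟙 _ := by
        rw [whisker_exchange]; monoidal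
    _ = _ := by
        rw [ExactPairing.coevaluation_evaluation'']; monoidal

theorem toDual_whiskerRight_dag :
    toDual A ▷ A ≫ dag (η_ (ᘁA : V) A) = (β_ A A).hom ≫ cap A := by
  rw [dag_coevaluation, BraidedCategory.braiding_naturality_left_assoc, whiskerLeft_toDual]

theorem cup_toDual (hA : IsDaggerFrobenius A) : cup A ≫ toDual A ▷ A = η_ (ᘁA : V) A := by
  calc _ = 𝟙 _ ⊗≫ (𝟙_ V ◁ cup A ≫ η_ (ᘁA : V) A ▷ (A ⊗ A)) ⊗≫ (ᘁA : V) ◁ cap A ▷ A ⊗≫ 𝟙 _ := by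
        simp only [toDual]; monoidal
    _ = η_ (ᘁA : V) A ⊗≫ (ᘁA : V) ◁ (A ◁ cup A ≫ (α_ _ _ _).inv ≫ cap A ▷ A) ⊗≫ 𝟙 _ := by
        rw [whisker_exchange]; monoidal
    _ = _ := by
        rw [cup_cap_right hA]; monoidal

theorem action_eq (hA : IsDaggerFrobenius A) : action A = comul A ≫ toDual A ▷ A := by
  rw [comul_eq_left hA, action, ← cup_toDual hA, Category.assoc, Category.assoc, Category.assoc,
    whisker_exchange]
  monoidal

theorem coaction_eq :
    coaction A = (ᘁA : V) ◁ comul A ≫ (α_ _ _ _).inv ≫ dag (η_ (ᘁA : V) A) ▷ A ≫ (λ_ A).hom := by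
  simp [coaction, action, dag_mul]

/-- `toDual` turns the action into the comultiplication, and turns the dagger of the duality cup
into the Frobenius form, up to a crossing that `hs` removes. -/
theorem action_comp_coaction (hA : IsDaggerFrobenius A) (hs : (β_ A A).hom ≫ cap A = cap A) :
    action A ≫ coaction A = comul A ≫ μ[A] := by
  calc _ = comul A ≫ (toDual A ▷ A ≫ (ᘁA : V) ◁ comul A) ≫ (α_ _ _ _).inv ≫
            dag (η_ (ᘁA : V) A) ▷ A ≫ (λ_ A).hom := by
        rw [action_eq hA, coaction_eq]; simp only [Category.assoc]
    _ = comul A ≫ A ◁ comul A ≫ (α_ _ _ _).inv ≫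
            (toDual A ▷ A ≫ dag (η_ (ᘁA : V) A)) ▷ A ≫ (λ_ A).hom := by
        rw [← whisker_exchange]; monoidal
    _ = comul A ≫ (A ◁ comul A ≫ (α_ _ _ _).inv ≫ μ[A] ▷ A) ≫ counit A ▷ A ≫ (λ_ A).hom := by
        rw [toDual_whiskerRight_dag, hs, cap]; simp only [Category.assoc, comp_whiskerRight]
    _ = comul A ≫ μ[A] ≫ (comul A ≫ counit A ▷ A) ≫ (λ_ A).hom := by
        rw [hA.frobenius_right]; simp only [Category.assoc]
    _ = _ := by
        rw [comul_counit_left]; simp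

theorem comul_mul (hA : IsDaggerFrobenius A) :
    comul A ≫ μ[A] = (λ_ A).inv ≫ (cup A ≫ μ[A]) ▷ A ≫ μ[A] := by
  rw [comp_whiskerRight, Category.assoc, mul_assoc, comul_eq_left hA]
  simp

theorem cup_braiding (hs : (β_ A A).hom ≫ cap A = cap A) : cup A ≫ (β_ A A).hom = cup A := by
  have := congrArg dag hs
  rwa [dag_comp, dag_braiding_hom, dag_cap] at this

theorem loop_eq_comul_cap (hA : IsDaggerFrobenius A) (hs : (β_ A A).hom ≫ cap A = cap A) :
    loop A = comul A ≫ cap A := by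
  have h : dag (ε_ (ᘁA : V) A) = cup A ≫ A ◁ toDual A := by
    rw [dag_evaluation_eq, ← cup_toDual hA, Category.assoc,
      BraidedCategory.braiding_naturality_left, reassoc_of% cup_braiding hs]
  calc _ = 𝟙 _ ⊗≫ A ◁ cup A ⊗≫ ((A ⊗ A) ◁ toDual A ≫ μ[A] ▷ (ᘁA : V)) ≫ ε_ (ᘁA : V) A := by
        rw [loop, h]; monoidal
    _ = ((ρ_ A).inv ≫ A ◁ cup A ≫ (α_ _ _ _).inv ≫ μ[A] ▷ A) ≫ A ◁ toDual A ≫ ε_ (ᘁA : V) A := by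
        rw [whisker_exchange]; monoidal
    _ = _ := by
        rw [whiskerLeft_toDual, ← comul_eq_right hA]

/-- Elements are separated by the Frobenius form. -/
theorem cup_cap_element (hA : IsDaggerFrobenius A) (a : 𝟙_ V ⟶ A) :
    cup A ≫ A ◁ ((ρ_ A).inv ≫ A ◁ a ≫ cap A) ≫ (ρ_ A).hom = a := by
  calc _ = 𝟙 _ ⊗≫ (cup A ▷ 𝟙_ V ≫ (A ⊗ A) ◁ a) ⊗≫ A ◁ cap A ⊗≫ 𝟙 _ := by monoidal
    _ = 𝟙 _ ⊗≫ a ⊗≫ (cup A ▷ A ≫ (α_ _ _ _).hom ≫ A ◁ cap A) ⊗≫ 𝟙 _ := by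
        rw [← whisker_exchange]; monoidal
    _ = _ := by rw [cup_cap_left hA]; monoidal

/-- The loop is the Frobenius form paired with the element `cup A ≫ μ[A]`. The normaliser equation
thus says that `z²` of this element pairs like the unit, and the form is nondegenerate. -/
theorem IsNormaliser.cup_mul {z : A ⟶ A} (hz : IsNormaliser z) (hA : IsDaggerFrobenius A)
    (hs : (β_ A A).hom ≫ cap A = cap A) : cup A ≫ μ[A] ≫ z ≫ z = η[A] := by
  have h1 : ∀ a : 𝟙_ V ⟶ A, (ρ_ A).inv ≫ A ◁ (a ≫ z ≫ z) ≫ cap A =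
      z ≫ z ≫ (ρ_ A).inv ≫ A ◁ a ≫ cap A := by
    intro a
    calc _ = (ρ_ A).inv ≫ A ◁ a ≫ (A ◁ (z ≫ z) ≫ μ[A]) ≫ counit A := by
          rw [cap]; simp only [whiskerLeft_comp, Category.assoc]
      _ = 𝟙 _ ⊗≫ (A ◁ a ≫ (z ≫ z) ▷ A) ≫ μ[A] ≫ counit A := by
          rw [hz.central.comp_right, ← hz.central.comp_left]; monoidal
      _ = _ := by
          rw [whisker_exchange, cap]; monoidal
  have h2 : comul A ≫ cap A = (ρ_ A).inv ≫ A ◁ (cup A ≫ μ[A]) ≫ cap A := by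
    rw [cap, comul_eq_right hA]; simp
  have h3 : (ρ_ A).inv ≫ A ◁ (cup A ≫ μ[A] ≫ z ≫ z) ≫ cap A = (ρ_ A).inv ≫ A ◁ η[A] ≫ cap A := by
    have h4 := hz.loop_eq
    rw [loop_eq_comul_cap hA hs, h2, ← h1, Category.assoc] at h4
    rw [h4, cap, ← Category.assoc (A ◁ η[A]), mul_one, Iso.inv_hom_id_assoc]
  rw [← cup_cap_element hA (cup A ≫ μ[A] ≫ z ≫ z), h3, cup_cap_element hA]

/-- `comul A ≫ μ[A]` is multiplication by the element `cup A ≫ μ[A]`, which `z²` sends to the unit.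
-/
theorem IsNormaliser.action_comp_coaction {z : A ⟶ A} (hz : IsNormaliser z)
    (hA : IsDaggerFrobenius A) (hs : (β_ A A).hom ≫ cap A = cap A) :
    z ≫ z ≫ action A ≫ coaction A = 𝟙 A := by
  rw [CPStar.action_comp_coaction hA hs, comul_mul hA]
  calc _ = 𝟙 _ ⊗≫ (𝟙_ V ◁ (z ≫ z) ≫ (cup A ≫ μ[A]) ▷ A) ≫ μ[A] := by monoidal
    _ = 𝟙 _ ⊗≫ (cup A ≫ μ[A]) ▷ A ≫ A ◁ (z ≫ z) ≫ μ[A] := by rw [whisker_exchange]; monoidal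
    _ = (λ_ A).inv ≫ (cup A ≫ μ[A] ≫ z ≫ z) ▷ A ≫ μ[A] := by
        rw [hz.central.comp_right.trans hz.central.comp_left.symm]; monoidal
    _ = _ := by rw [hz.cup_mul hA hs, MonObj.one_mul, Iso.inv_hom_id]

theorem IsNormaliser.dag_eq {z : A ⟶ A} (hz : IsNormaliser z) : dag z = z := by
  obtain ⟨⟨Y, h, rfl⟩, _⟩ := hz.posDef
  rw [dag_comp, dag_dag]

end Frobenius

/-! ### Traces, symmetry of the Frobenius form, and opposite algebras. -/

/-- The trace of right multiplications is a symmetric form. -/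
theorem action_trace_symm (C : V) [MonObj C] :
    (β_ C C).hom ≫ μ[C] ≫ action C ≫ dag (η_ (ᘁC : V) C) =
      μ[C] ≫ action C ≫ dag (η_ (ᘁC : V) C) := by
  rw [dag_coevaluation, reassoc_of% mul_action C,
    ← BraidedCategory.braiding_naturality_assoc]
  have := pantsMul_trace_symm (ᘁC : V) C (ᘁC : V) C
  simp only [pantsMul, Category.assoc]
  rw [this]

/-- The opposite of an algebra. -/
def Opp (A : V) : V := A

instance (A : V) [MonObj A] : MonObj (Opp A) where
  one := η[A]
  mul := (β_ A A).hom ≫ μ[A]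
  one_mul := by
    change η[A] ▷ A ≫ (β_ A A).hom ≫ μ[A] = (λ_ A).hom
    rw [BraidedCategory.braiding_naturality_left_assoc, MonObj.mul_one, braiding_rightUnitor]
  mul_one := by
    change A ◁ η[A] ≫ (β_ A A).hom ≫ μ[A] = (ρ_ A).hom
    rw [BraidedCategory.braiding_naturality_right_assoc, MonObj.one_mul, braiding_leftUnitor]
  mul_assoc := by
    change ((β_ A A).hom ≫ μ[A]) ▷ A ≫ (β_ A A).hom ≫ μ[A] =
      (α_ A A A).hom ≫ A ◁ ((β_ A A).hom ≫ μ[A]) ≫ (β_ A A).hom ≫ μ[A]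
    have h1 : (α_ A A A).hom ≫ (β_ A (A ⊗ A)).hom ≫ (β_ A A).hom ▷ A =
        (β_ A A).hom ▷ A ≫ (β_ (A ⊗ A) A).hom ≫ (α_ A A A).inv := by
      simp [BraidedCategory.braiding_tensor_left_hom, BraidedCategory.braiding_tensor_right_hom]
    rw [comp_whiskerRight, whiskerLeft_comp, Category.assoc, Category.assoc,
      BraidedCategory.braiding_naturality_left_assoc,
      BraidedCategory.braiding_naturality_right_assoc,
      BraidedCategory.braiding_naturality_right_assoc, MonObj.mul_assoc,
      reassoc_of% h1, Iso.inv_hom_id_assoc]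

/-- The bracket is `action (Opp A)` written out, so the loop is the trace of left multiplications
and `action_trace_symm` applies to it. -/
theorem loop_eq_trace (A : V) [MonObj A] :
    loop A = ((λ_ A).inv ≫ η_ (ᘁA : V) A ▷ A ≫ (α_ (ᘁA : V) A A).hom ≫
      (ᘁA : V) ◁ ((β_ A A).hom ≫ μ[A])) ≫ dag (η_ (ᘁA : V) A) := by
  have h : (λ_ A).inv ≫ η_ (ᘁA : V) A ▷ A = (ρ_ A).inv ≫ A ◁ η_ (ᘁA : V) A ≫ (β_ _ _).hom := by
    rw [BraidedCategory.braiding_naturality_right, ← leftUnitor_inv_braiding_assoc,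
      SymmetricCategory.symmetry_assoc]
  simp only [Category.assoc, whiskerLeft_comp, dag_coevaluation, reassoc_of% h]
  rw [BraidedCategory.braiding_naturality_right_assoc (ᘁA : V) μ[A],
    reassoc_of% braiding_reverse, loop, dag_evaluation_eq]
  simp only [Category.assoc, whiskerLeft_comp]

/-- The loop is a trace. -/
theorem loop_symm (A : V) [MonObj A] : (β_ A A).hom ≫ μ[A] ≫ loop A = μ[A] ≫ loop A := by
  have h : (β_ A A).hom ≫ ((β_ A A).hom ≫ μ[A]) ≫
        ((λ_ A).inv ≫ η_ (ᘁA : V) A ▷ A ≫ (α_ (ᘁA : V) A A).hom ≫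
          (ᘁA : V) ◁ ((β_ A A).hom ≫ μ[A])) ≫ dag (η_ (ᘁA : V) A) =
      ((β_ A A).hom ≫ μ[A]) ≫ ((λ_ A).inv ≫ η_ (ᘁA : V) A ▷ A ≫ (α_ (ᘁA : V) A A).hom ≫
          (ᘁA : V) ◁ ((β_ A A).hom ≫ μ[A])) ≫ dag (η_ (ᘁA : V) A) :=
    action_trace_symm (Opp A)
  rw [← loop_eq_trace, Category.assoc, SymmetricCategory.symmetry_assoc] at h
  exact h.symm

/-- The counit is the loop after `z²`; the loop is a trace, and centrality lets `z²` sit on either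
argument. -/
theorem IsNormalisable.cap_symm {A : V} [MonObj A] (hA : IsNormalisable A) :
    (β_ A A).hom ≫ cap A = cap A := by
  obtain ⟨hF, z, hz⟩ := hA
  calc _ = (β_ A A).hom ≫ (A ◁ (z ≫ z) ≫ μ[A]) ≫ loop A := by
        rw [cap, ← hz.loop_eq, hz.central.comp_right]; simp only [Category.assoc]
    _ = (z ≫ z) ▷ A ≫ (β_ A A).hom ≫ μ[A] ≫ loop A := by
        rw [BraidedCategory.braiding_naturality_left_assoc, Category.assoc]
    _ = ((z ≫ z) ▷ A ≫ μ[A]) ≫ loop A := by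
        rw [loop_symm, Category.assoc]
    _ = _ := by
        rw [hz.central.comp_left, cap, ← hz.loop_eq]; simp only [Category.assoc]

theorem IsDaggerFrobenius.opp {A : V} [MonObj A] (hA : IsDaggerFrobenius A) :
    IsDaggerFrobenius (Opp A) where
  frobenius_left := by
    change dag ((β_ A A).hom ≫ μ[A]) ▷ A ≫ (α_ A A A).hom ≫ A ◁ ((β_ A A).hom ≫ μ[A]) =
      ((β_ A A).hom ≫ μ[A]) ≫ dag ((β_ A A).hom ≫ μ[A])
    have h : ((β_ A A).hom ▷ A ≫ (α_ A A A).hom ≫ A ◁ (β_ A A).hom) =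
        (β_ (A ⊗ A) A).hom ≫ (α_ A A A).inv ≫ (β_ (A ⊗ A) A).hom := by
      have := braiding_cyclic A A A
      rw [Iso.eq_inv_comp] at this
      rw [← reassoc_of% this, SymmetricCategory.symmetry, Category.comp_id]
      simp [BraidedCategory.braiding_tensor_right_hom]
    rw [dag_comp, dag_braiding_hom, dag_mul, comp_whiskerRight, whiskerLeft_comp, Category.assoc,
      reassoc_of% h, BraidedCategory.braiding_naturality_left_assoc,
      ← BraidedCategory.braiding_naturality_left, Category.assoc, ← reassoc_of% hA.frobenius_right]
  frobenius_right := by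
    change A ◁ dag ((β_ A A).hom ≫ μ[A]) ≫ (α_ A A A).inv ≫ ((β_ A A).hom ≫ μ[A]) ▷ A =
      ((β_ A A).hom ≫ μ[A]) ≫ dag ((β_ A A).hom ≫ μ[A])
    have h : (A ◁ (β_ A A).hom ≫ (α_ A A A).inv ≫ (β_ A A).hom ▷ A) =
        (β_ A (A ⊗ A)).hom ≫ (α_ A A A).hom ≫ (β_ A (A ⊗ A)).hom := by
      rw [braiding_cyclic]
      simp [BraidedCategory.braiding_tensor_left_hom]
    rw [dag_comp, dag_braiding_hom, dag_mul, comp_whiskerRight, whiskerLeft_comp, Category.assoc,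
      reassoc_of% h, BraidedCategory.braiding_naturality_right_assoc,
      ← BraidedCategory.braiding_naturality_right, Category.assoc, ← reassoc_of% hA.frobenius_left]

/-- The opposite of a normalisable algebra is normalisable. -/
theorem IsNormalisable.opp {A : V} [MonObj A] (hA : IsNormalisable A) :
    IsNormalisable (Opp A) := by
  have hs := hA.cap_symm
  obtain ⟨hF, z, hz⟩ := hA
  have hcap : (β_ A A).hom ≫ ((β_ A A).hom ≫ μ[A]) ≫ counit A = ((β_ A A).hom ≫ μ[A]) ≫
      counit A := by
    rw [cap] at hs
    rw [Category.assoc, hs, hs]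
  -- Both loops have the form `comul ≫ cap`, where the crossings in the opposite comultiplication
  -- and multiplication cancel.
  have hloop : loop (Opp A) = loop A := by
    refine (loop_eq_comul_cap hF.opp hcap).trans ?_
    change dag ((β_ A A).hom ≫ μ[A]) ≫ ((β_ A A).hom ≫ μ[A]) ≫ counit A = _
    rw [loop_eq_comul_cap hF hs, dag_comp, dag_braiding_hom, dag_mul, cap]
    simp
  refine ⟨hF.opp, z, ⟨⟨?_, ?_⟩, hz.posDef, ?_⟩⟩
  · change z ▷ A ≫ (β_ A A).hom ≫ μ[A] = ((β_ A A).hom ≫ μ[A]) ≫ z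
    rw [BraidedCategory.braiding_naturality_left_assoc, hz.central.right, Category.assoc]
  · change A ◁ z ≫ (β_ A A).hom ≫ μ[A] = ((β_ A A).hom ≫ μ[A]) ≫ z
    rw [BraidedCategory.braiding_naturality_right_assoc, hz.central.left, Category.assoc]
  · rw [hloop]
    exact hz.loop_eq

/-! ### Positivity along the embedding into a matrix algebra. -/

theorem shuffle_comp_dag (A C : V) : shuffle A C ≫ dag (shuffle A C) = 𝟙 _ := by
  simp only [shuffle, dag_comp, dag_associator_hom, dag_associator_inv, dag_whiskerRight,
    dag_braiding_hom, Category.assoc, Iso.hom_inv_id_assoc, ← comp_whiskerRight_assoc,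
    SymmetricCategory.symmetry, id_whiskerRight, Category.id_comp, Iso.inv_hom_id]

theorem isPositiveMap_rightMul_actionHom {A C : V} [MonObj A] [MonObj C] {p : 𝟙_ V ⟶ A ⊗ C}
    (hp : IsPositiveMap (rightMul p)) : IsPositiveMap (rightMul (p ≫ A ◁ actionHom C)) := by
  have h := isPositiveMap_sandwich (shuffle A C) (isPositiveMap_whiskerLeft (ᘁC : V) hp)
  rw [← Category.assoc, ← tensor_mul_action_shuffle, Category.assoc, shuffle_comp_dag,
    Category.comp_id] at h
  exact h

/-- Pushing a positive element along an action gives a positive element. -/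
theorem IsPositiveElement.comp_action {A C : V} [MonObj A] [MonObj C] {p : 𝟙_ V ⟶ A ⊗ C}
    (hp : IsPositiveElement p) : IsPositiveElement (p ≫ A ◁ actionHom C) := by
  rw [isPositiveElement_iff] at hp ⊢
  exact isPositiveMap_rightMul_actionHom hp

/-- Positivity is detected by the action of a normalisable algebra. -/
theorem IsNormalisable.isPositiveElement_of_comp_action {B C : V} [MonObj B] [MonObj C]
    (hC : IsNormalisable C) {p : 𝟙_ V ⟶ B ⊗ C}
    (hp : IsPositiveElement (p ≫ B ◁ actionHom C)) : IsPositiveElement p := by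
  have hs := hC.cap_symm
  obtain ⟨hF, z, hz⟩ := hC
  have hact : z ≫ z ≫ actionHom C ≫ dag (actionHom C) = 𝟙 C := hz.action_comp_coaction hF hs
  have := hz.posDef.2
  -- Cancelling the invertible `z` on the left moves one copy to the right, so `z ≫ actionHom C` is
  -- an isometry.
  have hact' : z ≫ actionHom C ≫ dag (actionHom C) ≫ z = 𝟙 C := by
    rw [← cancel_epi z, reassoc_of% hact, Category.comp_id]
  rw [isPositiveElement_iff] at hp ⊢
  have h := isPositiveMap_sandwich (B ◁ z ≫ B ◁ actionHom C) hp
  rw [dag_comp, dag_whiskerLeft, dag_whiskerLeft, hz.dag_eq, Category.assoc,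
    reassoc_of% rightMul_comp_whiskerLeft (mul_actionHom C) p,
    reassoc_of% hz.central.rightMul_comp p] at h
  have h' : B ◁ z ≫ B ◁ actionHom C ≫ B ◁ dag (actionHom C) ≫ B ◁ z = 𝟙 _ := by
    have := congrArg (B ◁ ·) hact'
    simpa only [whiskerLeft_comp, whiskerLeft_id] using this
  rwa [h', Category.comp_id] at h

/-! ### The cup as a universal test element. -/

/-- With the cup written as `∑ xᵢ ⊗ yᵢ`, multiplying `b ⊗ a` in `B ⊗ Aᵒᵖ` gives `∑ b f(xᵢ) ⊗ yᵢ a`,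
and `∑ xᵢ ⊗ yᵢ a` is the comultiplication of `a`. The opposite product is what puts `yᵢ` on the left
of `a`. -/
theorem tensor_mul_cup {A B : V} [MonObj A] [MonObj B] (hA : IsDaggerFrobenius A) (f : A ⟶ B) :
    (ρ_ (B ⊗ A)).inv ≫ (B ⊗ A) ◁ (cup A ≫ f ▷ A) ≫ tensorμ B A B A ≫
        (μ[B] ⊗ₘ ((β_ A A).hom ≫ μ[A])) =
      B ◁ (comul A ≫ f ▷ A) ≫ (α_ B B A).inv ≫ μ[B] ▷ A := by
  calc _ = 𝟙 _ ⊗≫ (B ⊗ A) ◁ cup A ⊗≫ B ◁ (A ◁ f ≫ (β_ A B).hom) ▷ A ⊗≫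
            (B ⊗ B) ◁ ((β_ A A).hom ≫ μ[A]) ⊗≫ μ[B] ▷ A := by
        rw [MonoidalCategory.tensorHom_def']; simp only [tensorμ]; monoidal
    _ = 𝟙 _ ⊗≫ (B ⊗ A) ◁ cup A ⊗≫ B ◁ (β_ A A).hom ▷ A ⊗≫ B ◁ (f ▷ (A ⊗ A) ≫
            B ◁ ((β_ A A).hom ≫ μ[A])) ⊗≫ μ[B] ▷ A := by
        rw [BraidedCategory.braiding_naturality_right]; monoidal
    _ = 𝟙 _ ⊗≫ B ◁ (A ◁ cup A ≫ (β_ A (A ⊗ A)).hom) ⊗≫ B ◁ (A ◁ μ[A] ≫ f ▷ A) ⊗≫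
            μ[B] ▷ A := by
        rw [← whisker_exchange, BraidedCategory.braiding_tensor_right_hom]; monoidal
    _ = 𝟙 _ ⊗≫ B ◁ ((λ_ A).inv ≫ cup A ▷ A ≫ (α_ _ _ _).hom ≫ A ◁ μ[A]) ⊗≫
            B ◁ f ▷ A ⊗≫ μ[B] ▷ A := by
        rw [BraidedCategory.braiding_naturality_right, braiding_tensorUnit_right]; monoidal
    _ = _ := by
        rw [← comul_eq_left hA]; monoidal

/-- The cup as an element of `A ⊗ Aᵒᵖ`. -/
def cupOpp (A : V) [MonObj A] : 𝟙_ V ⟶ A ⊗ Opp A := cup A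

theorem isPositiveMap_rightMul_cupOpp {A B : V} [MonObj A] [MonObj B] (hA : IsDaggerFrobenius A)
    (f : A ⟶ B) : IsPositiveMap (rightMul (cupOpp A ≫ f ▷ Opp A)) ↔
      IsPositiveMap (B ◁ (comul A ≫ f ▷ A) ≫ (α_ B B A).inv ≫ μ[B] ▷ A) := by
  rw [← tensor_mul_cup hA f]
  exact Iff.rfl

theorem isPositiveElement_cupOpp {A : V} [MonObj A] (hA : IsDaggerFrobenius A) :
    IsPositiveElement (cupOpp A) := by
  -- For the identity map, the Frobenius law factors right multiplication by the cup as `μ[A] ≫ dag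
  -- μ[A]`.
  have h := (isPositiveMap_rightMul_cupOpp hA (𝟙 A)).2 ⟨A, μ[A], by
    rw [id_whiskerRight, Category.comp_id, hA.frobenius_right, dag_mul]⟩
  rw [id_whiskerRight, Category.comp_id] at h
  exact (isPositiveElement_iff _).2 h

theorem comul_cap {A : V} [MonObj A] (hA : IsDaggerFrobenius A) :
    comul A ▷ A ≫ (α_ A A A).hom ≫ A ◁ cap A = μ[A] ≫ (ρ_ A).inv := by
  rw [cap, whiskerLeft_comp, reassoc_of% hA.frobenius_left, comul_counit_right]

/-- The `A*` input can be bent into `A` from either side of the cup, because the cup is symmetric.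
-/
theorem coaction_eq_cup {A : V} [MonObj A] (hA : IsDaggerFrobenius A)
    (hs : (β_ A A).hom ≫ cap A = cap A) :
    coaction A = 𝟙 _ ⊗≫ cup A ▷ ((ᘁA : V) ⊗ A) ⊗≫ A ◁ ε_ (ᘁA : V) A ▷ A ⊗≫ μ[A] := by
  have h1 : (ρ_ _).inv ≫ (ᘁA : V) ◁ cup A = (λ_ _).inv ≫ cup A ▷ (ᘁA : V) ≫ (β_ _ _).hom := by
    rw [BraidedCategory.braiding_naturality_left, leftUnitor_inv_braiding_assoc]
  have h2 : ε_ (ᘁA : V) A ▷ A ≫ (λ_ A).hom = (β_ _ _).hom ≫ A ◁ ε_ (ᘁA : V) A ≫ (ρ_ A).hom := by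
    rw [← BraidedCategory.braiding_naturality_left_assoc, braiding_rightUnitor]
  have h3 : (β_ A A).hom ▷ (ᘁA : V) ≫ (β_ (A ⊗ A) (ᘁA : V)).hom ≫ (α_ _ _ _).inv ≫
      (β_ (ᘁA : V) A).hom ▷ A ≫ (β_ (A ⊗ (ᘁA : V)) A).hom = (α_ _ _ _).hom := by
    simp only [BraidedCategory.braiding_tensor_left_hom, Category.assoc, Iso.inv_hom_id_assoc,
      Iso.hom_inv_id_assoc, ← whiskerLeft_comp_assoc, ← comp_whiskerRight_assoc,
      SymmetricCategory.symmetry, whiskerLeft_id, id_whiskerRight, Category.id_comp]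
  have h4 : (ρ_ _).inv ≫ (ᘁA : V) ◁ cup A ≫ (α_ _ _ _).inv ≫ dag (η_ (ᘁA : V) A) ▷ A ≫ (λ_ A).hom =
      (λ_ _).inv ≫ cup A ▷ (ᘁA : V) ≫ (α_ _ _ _).hom ≫ A ◁ ε_ (ᘁA : V) A ≫ (ρ_ A).hom := by
    rw [reassoc_of% h1, dag_coevaluation, comp_whiskerRight, Category.assoc, h2]
    conv_lhs => rw [← cup_braiding hs]
    rw [comp_whiskerRight, Category.assoc, reassoc_of% h3]
  calc _ = 𝟙 _ ⊗≫ ((ᘁA : V) ◁ cup A) ▷ A ⊗≫ ((((ᘁA : V) ⊗ A) ◁ μ[A]) ≫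
            dag (η_ (ᘁA : V) A) ▷ A) ⊗≫ 𝟙 _ := by
        rw [coaction_eq, comul_eq_left hA]; monoidal
    _ = 𝟙 _ ⊗≫ ((ρ_ _).inv ≫ (ᘁA : V) ◁ cup A ≫ (α_ _ _ _).inv ≫ dag (η_ (ᘁA : V) A) ▷ A ≫
            (λ_ A).hom) ▷ A ⊗≫ μ[A] := by
        rw [whisker_exchange]; monoidal
    _ = _ := by
        rw [h4]; monoidal

/-- Positivity of the image of the cup in `B ⊗ Aᵒᵖ` gives the CP*-condition. -/
theorem satisfiesCPStar_of_cup {A B : V} [MonObj A] [MonObj B] (hA : IsDaggerFrobenius A)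
    (hs : (β_ A A).hom ≫ cap A = cap A) {f : A ⟶ B}
    (hf : IsPositiveElement (cupOpp A ≫ f ▷ Opp A)) : SatisfiesCPStar f := by
  obtain ⟨Y, h, hh⟩ := (isPositiveMap_rightMul_cupOpp hA f).1 ((isPositiveElement_iff _).1 hf)
  -- The Stinespring map is `h : B ⊗ A ⟶ Y` with its `A` input bent to an output by the cup.
  refine (satisfiesCPStar_iff f).2 ⟨Y, (ρ_ B).inv ≫ B ◁ cup A ≫ (α_ _ _ _).inv ≫ h ▷ A, ?_⟩
  symm
  calc _ = 𝟙 _ ⊗≫ B ◁ cup A ▷ ((ᘁA : V) ⊗ A) ⊗≫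
            (h ▷ (A ⊗ ((ᘁA : V) ⊗ A)) ≫ Y ◁ ((α_ _ _ _).inv ≫ ε_ (ᘁA : V) A ▷ A ≫ (λ_ A).hom)) ⊗≫
            dag h ▷ A ⊗≫ B ◁ cap A ⊗≫ 𝟙 _ := by
        rw [← dag_cap]
        simp only [stinespringForm, dag_comp, dag_whiskerRight, dag_whiskerLeft, dag_dag,
          dag_associator_inv, dag_rightUnitor_inv]
        monoidal
    _ = 𝟙 _ ⊗≫ B ◁ cup A ▷ ((ᘁA : V) ⊗ A) ⊗≫
            (B ⊗ A) ◁ ((α_ _ _ _).inv ≫ ε_ (ᘁA : V) A ▷ A ≫ (λ_ A).hom) ≫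
            (h ≫ dag h) ▷ A ⊗≫ B ◁ cap A ⊗≫ 𝟙 _ := by
        rw [← whisker_exchange]; monoidal
    _ = 𝟙 _ ⊗≫ B ◁ cup A ▷ ((ᘁA : V) ⊗ A) ⊗≫ B ◁ A ◁ ε_ (ᘁA : V) A ▷ A ⊗≫ B ◁ comul A ▷ A ⊗≫
            B ◁ f ▷ (A ⊗ A) ⊗≫ (μ[B] ▷ (A ⊗ A) ≫ B ◁ cap A) ⊗≫ 𝟙 _ := by
        rw [← hh]; monoidal
    _ = 𝟙 _ ⊗≫ B ◁ cup A ▷ ((ᘁA : V) ⊗ A) ⊗≫ B ◁ A ◁ ε_ (ᘁA : V) A ▷ A ⊗≫ B ◁ comul A ▷ A ⊗≫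
            B ◁ (f ▷ (A ⊗ A) ≫ B ◁ cap A) ⊗≫ μ[B] ⊗≫ 𝟙 _ := by
        rw [← whisker_exchange]; monoidal
    _ = 𝟙 _ ⊗≫ B ◁ cup A ▷ ((ᘁA : V) ⊗ A) ⊗≫ B ◁ A ◁ ε_ (ᘁA : V) A ▷ A ⊗≫
            B ◁ (comul A ▷ A ≫ (α_ _ _ _).hom ≫ A ◁ cap A) ⊗≫ B ◁ f ⊗≫ μ[B] ⊗≫ 𝟙 _ := by
        rw [← whisker_exchange]; monoidal
    _ = _ := by
        rw [comul_cap hA, coaction_eq_cup hA hs]; monoidal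

end DaggerCompact

end CPStar


theorem mainTheorem3 {V : Type*} [Category* V] [MonoidalCategory V] [SymmetricCategory V]
    [LeftRigidCategory V] [CPStar.DaggerCompactCategory V]
    (A B : V) [MonObj A] [MonObj B]
    (hA : CPStar.IsNormalisable A) (hB : CPStar.IsNormalisable B) (f : A ⟶ B) :
    List.TFAE [
      CPStar.SatisfiesCPStar f,
      ∀ (C : V) [MonObj C], CPStar.IsNormalisable C → CPStar.PreservesPositive (f ▷ C),
      ∀ X : V, CPStar.PreservesPositive (f ▷ CPStar.MatrixAlg X)] := by
  -- The dilation works for every monoid `C`, so matrix algebras are covered without showing them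
  -- normalisable.
  have key : CPStar.SatisfiesCPStar f → ∀ (C : V) [MonObj C], CPStar.PreservesPositive (f ▷ C) := by
    intro hf C _ p hp
    have hs := hA.cap_symm
    obtain ⟨hF, z, hz⟩ := hA
    obtain ⟨X, k, hk⟩ := CPStar.exists_dilation hf z hz.central hz.dag_eq
      (hz.action_comp_coaction hF hs)
    rw [CPStar.isPositiveElement_iff] at hp ⊢
    rw [CPStar.rightMul_comp_whiskerRight hk]
    exact CPStar.isPositiveMap_sandwich _ (CPStar.isPositiveMap_whiskerLeft X hp)
  tfae_have 1 → 3 := fun hf X => key hf _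
  tfae_have 3 → 2 := by
    intro h C _ hC p hp
    refine hC.isPositiveElement_of_comp_action ?_
    have h1 := h C _ hp.comp_action
    -- `f` and the action of `C` act on different tensor factors, so they commute.
    rwa [Category.assoc, whisker_exchange, ← Category.assoc] at h1
  tfae_have 2 → 1 := fun h => CPStar.satisfiesCPStar_of_cup hA.frobenius hA.cap_symm
    (h (CPStar.Opp A) hA.opp (CPStar.cupOpp A) (CPStar.isPositiveElement_cupOpp hA.frobenius))
  tfae_finish
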